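/- **Setting.** Let $\mathcal U$ (identifiers), $\mathcal L$ (literals) and $\mathcal V$ (variables) be pairwise disjoint countable, totally ordered sets, where every element of $\mathcal U$ has only finitely many predecessors. A *data triple* is an element of $\mathcal U\times\mathcal U\times(\mathcal U\cup\mathcal L)$. A *Web of Linked Data* is a tuple $W=(D,\mathrm{data},\mathrm{adoc})$ with a countable (finite or infinite) set $D$ of documents, a map $\mathrm{data}$ that assigns a finite set of data triples to each document, and a partial surjective map $\mathrm{adoc}:\mathcal U\rightharpoonup D$. A *basic query pattern* (BQP) is a finite set $P\subset(\mathcal V\cup\mathcal U)\times(\mathcal V\cup\mathcal U)\times(\mathcal V\cup\mathcal U\cup\mathcal L)$. A *reachability criterion* is a function $c$ that maps each data triple $t$, identifier $u$ and BQP $P$ to true or false; $c_{\mathsf{None}}$ is constantly false. **Queries.** For a finite set $S\subset\mathcal U$ of seed identifiers, the $(c,P)$-reachable documents of $W$ form the least set that contains $\mathrm{adoc}(u)$ for all $u\in S\cap\mathrm{dom}(\mathrm{adoc})$ and, whenever $d'$ is in the set, $t\in\mathrm{data}(d')$, $u\in\mathrm{dom}(\mathrm{adoc})$ is an identifier that occurs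 in $t$, and $c(t,u,P)$ is true, contains $\mathrm{adoc}(u)$. The *CLD query* $\mathcal Q^{P,S}_c$ maps $W$ to the set of all partial maps $\mu:\mathcal V\rightharpoonup\mathcal U\cup\mathcal L$ (valuations) such that $\mathrm{dom}(\mu)$ is the set of variables of $P$, and $\mu[P]$ (replace each variable in $P$ by its value) is contained in the set of all data triples of the $(c,P)$-reachable documents. **Encodings.** Fix binary representations $\mathrm{enc}(x)$ of the elements $x$ of $\mathcal U\cup\mathcal L$, and of those of $\mathcal V$, each injective. Then $\mathrm{enc}(s,p,o)=\langle\,\mathrm{enc}(s),\mathrm{enc}(p),\mathrm{enc}(o)\,\rangle$; a finite set $T$ of data triples has the encoding $\langle\!\langle\,\mathrm{enc}(t_1),\dots,\mathrm{enc}(t_n)\,\rangle\!\rangle$, with its elements in lexicographic order; $\mathrm{enc}(d)=\mathrm{enc}(\mathrm{data}(d))$; $\mathrm{enc}(W)=\sharp\,\mathrm{enc}(u_1)\,\mathrm{enc}(\mathrm{adoc}(u_1))\,\sharp\,\mathrm{enc}(u_2)\,\mathrm{enc}(\mathrm{adoc}(u_2))\,\sharp\cdots$, where $u_1<u_2<\cdots$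 are the elements of $\mathrm{dom}(\mathrm{adoc})$; $\mathrm{enc}(\mu)=\langle\!\langle\,\mathrm{enc}(v_1)\to\mathrm{enc}(\mu(v_1)),\dots,\mathrm{enc}(v_n)\to\mathrm{enc}(\mu(v_n))\,\rangle\!\rangle$ with $v_1<\dots<v_n$ the elements of $\mathrm{dom}(\mu)$; and a possible encoding of a finite set of valuations is the concatenation of the encodings of its elements, in any order, without repetition. **Machines.** An *LD machine* is a multi-tape Turing machine with finitely many states, among them a special state *expand*, and with five tapes: a read-only input tape (empty here), a right-infinite Web tape that contains $\mathrm{enc}(W)$ and is used only in the expand state, a two-way infinite work tape, a right-infinite link traversal tape (a second work tape), and a right-infinite, append-only output tape; work, link traversal and output tapes are empty initially. In the expand state it first performs the following procedure: if the word on the link traversal tape ends in $\mathrm{enc}(u)$ for some identifier $u$ (as its maximal suffix of binary digits) and the Web tape contains $\sharp\,\mathrm{enc}(u)\,\mathrm{enc}(\mathrm{adoc}(u))\,\sharp$, then $\mathrm{enc}(\mathrm{adoc}(u))\,\sharp$ is appended to the word on the link traversal tape; otherwise $\sharp$ is appended. A query $q$ is *finitely computable* if there is an LD machine which, for every Web of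 Linked Data $W$ encoded on its Web tape, halts after finitely many steps with a possible encoding of $q(W)$ on its output tape. **Corollary.** Let $P$ be a BQP. 1. For every reachability criterion $c$, the CLD query $\mathcal Q^{P,\emptyset}_c$ (empty set of seed identifiers) is finitely computable. 2. For every finite set $S\subset\mathcal U$, the CLD query $\mathcal Q^{P,S}_{c_{\mathsf{None}}}$ is finitely computable. -/

import Mathlib

namespace LinkedData

/-! ## Data model -/

/-- A data triple, an element of `U × U × (U ∪ L)`; `U` is the set of identifiers and `L` the
(disjoint) set of literals. -/
@[ext]
structure DataTriple (U L : Type*) where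
  subj : U
  pred : U
  obj : U ⊕ L

/-- The identifiers that occur in a data triple. -/
def DataTriple.ids {U L : Type*} (t : DataTriple U L) : Set U :=
  {u | u = t.subj ∨ u = t.pred ∨ Sum.inl u = t.obj}

/-- The lexicographic order of data triples (in object position, identifiers precede literals). -/
noncomputable instance DataTriple.instLinearOrder {U L : Type*} [LinearOrder U] [LinearOrder L] :
    LinearOrder (DataTriple U L) :=
  LinearOrder.lift' (β := U ×ₗ (U ×ₗ (U ⊕ₗ L)))
    (fun t => toLex (t.subj, toLex (t.pred, toLex t.obj)))
    (fun s t h => by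
      have h1 := Prod.ext_iff.1 (toLex.injective h)
      have h2 := Prod.ext_iff.1 (toLex.injective h1.2)
      exact DataTriple.ext h1.1 h2.1 (toLex.injective h2.2))

/-- A Web of Linked Data `(D, data, adoc)`: a countable (finite or infinite) set `D` of documents,
a finite set of data triples for each document, and a partial surjective map `adoc` from
identifiers to documents (`adoc u = none` means that `adoc` is undefined at `u`). -/
structure Web (U L : Type*) where
  D : Type
  countable : Countable D
  data : D → Finset (DataTriple U L)
  adoc : U → Option D
  adoc_surjective : ∀ d, ∃ u, adoc u = some d

/-- All data triples of a Web. -/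
def Web.allData {U L : Type*} (W : Web U L) : Set (DataTriple U L) :=
  {t | ∃ d : W.D, t ∈ W.data d}

open Classical in
/-- The subweb of `W` that is induced by a set `D'` of documents. -/
noncomputable def Web.induced {U L : Type*} (W : Web U L) (D' : Set W.D) : Web U L where
  D := D'
  countable := by
    have := W.countable
    infer_instance
  data d := W.data d.1
  adoc u := (W.adoc u).bind fun d => if h : d ∈ D' then some ⟨d, h⟩ else none
  adoc_surjective := by
    rintro ⟨d, hd⟩
    obtain ⟨u, hu⟩ := W.adoc_surjective d
    exact ⟨u, by simp [hu, hd]⟩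

/-! ## Query model -/

/-- A triple pattern, an element of `(V ∪ U) × (V ∪ U) × (V ∪ U ∪ L)`; `V` is the set of
variables. -/
structure TriplePattern (U L V : Type*) where
  subj : V ⊕ U
  pred : V ⊕ U
  obj : V ⊕ (U ⊕ L)

/-- A basic query pattern is a finite set of triple patterns. -/
abbrev BQP (U L V : Type*) := Finset (TriplePattern U L V)

/-- The variables that occur in a triple pattern. -/
def TriplePattern.vars {U L V : Type*} (tp : TriplePattern U L V) : Set V :=
  {v | Sum.inl v = tp.subj ∨ Sum.inl v = tp.pred ∨ Sum.inl v = tp.obj}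

/-- The variables that occur in a basic query pattern. -/
def BQP.vars {U L V : Type*} (P : BQP U L V) : Set V := {v | ∃ tp ∈ P, v ∈ tp.vars}

/-- A valuation is a partial map with finite domain from variables to identifiers and literals. -/
structure Valuation (U L V : Type*) where
  toFun : V → Option (U ⊕ L)
  finite_dom : {v | (toFun v).isSome}.Finite

/-- The domain of a valuation. -/
def Valuation.dom {U L V : Type*} (μ : Valuation U L V) : Set V := {v | (μ.toFun v).isSome}

/-- Replacing a variable in the domain of `μ` by its value; other terms are left unchanged. -/
def Valuation.subst {U L V : Type*} (μ : Valuation U L V) : V ⊕ (U ⊕ L) → V ⊕ (U ⊕ L)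
  | Sum.inl v => (μ.toFun v).elim (Sum.inl v) Sum.inr
  | Sum.inr x => Sum.inr x

/-- The tuple `μ[tp]` that results from applying a valuation to a triple pattern. -/
def Valuation.apply {U L V : Type*} (μ : Valuation U L V) (tp : TriplePattern U L V) :
    (V ⊕ (U ⊕ L)) × (V ⊕ (U ⊕ L)) × (V ⊕ (U ⊕ L)) :=
  (μ.subst (tp.subj.map id Sum.inl), μ.subst (tp.pred.map id Sum.inl), μ.subst tp.obj)

/-- A data triple, as a tuple of terms. -/
def DataTriple.toTuple {U L V : Type*} (t : DataTriple U L) :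
    (V ⊕ (U ⊕ L)) × (V ⊕ (U ⊕ L)) × (V ⊕ (U ⊕ L)) :=
  (Sum.inr (Sum.inl t.subj), Sum.inr (Sum.inl t.pred), Sum.inr t.obj)

/-- A reachability criterion decides, for a query pattern, which links of a triple to follow. -/
abbrev ReachabilityCriterion (U L V : Type*) := DataTriple U L → U → BQP U L V → Bool

/-- The criterion `c_None`, which is constantly false. -/
def cNone {U L V : Type*} : ReachabilityCriterion U L V := fun _ _ _ => false

/-- The documents of `W` that are `(c, P)`-reachable from the seed identifiers `S`. -/
inductive Reachable {U L V : Type*} (S : Finset U) (c : ReachabilityCriterion U L V)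
    (P : BQP U L V) (W : Web U L) : W.D → Prop
  | seed (u : U) (d : W.D) : u ∈ S → W.adoc u = some d → Reachable S c P W d
  | link (d' : W.D) (t : DataTriple U L) (u : U) (d : W.D) :
      Reachable S c P W d' → t ∈ W.data d' → u ∈ t.ids → c t u P = true →
        W.adoc u = some d → Reachable S c P W d

/-- The `(S, c, P)`-reachable part of `W`. -/
noncomputable def reachablePart {U L V : Type*} (S : Finset U) (c : ReachabilityCriterion U L V)
    (P : BQP U L V) (W : Web U L) : Web U L :=
  W.induced {d | Reachable S c P W d}

/-- A Linked Data query maps each Web of Linked Data to a set of valuations. -/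
abbrev LDQuery (U L V : Type*) := Web U L → Set (Valuation U L V)

/-- The conjunctive Linked Data query (CLD query) that uses the basic query pattern `P`, the finite
set `S` of seed identifiers and the reachability criterion `c`. -/
def cldQuery {U L V : Type*} (P : BQP U L V) (S : Finset U) (c : ReachabilityCriterion U L V) :
    LDQuery U L V :=
  fun W => {μ | μ.dom = BQP.vars P ∧
    μ.apply '' {tp | tp ∈ P} ⊆ DataTriple.toTuple '' (reachablePart S c P W).allData}

/-! ## Encodings -/

/-- The symbols used by encodings: binary digits, `♯`, angle brackets `⟨` and `⟩`, double angle
brackets `⟪` and `⟫`, comma, and arrow. -/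
inductive Symb
  | bit (b : Bool)
  | sharp
  | langle
  | rangle
  | ldangle
  | rdangle
  | comma
  | arrow

/-- Binary representations of the identifiers and literals, and of the variables. -/
structure Encoding (U L V : Type*) where
  bits : U ⊕ L → List Bool
  bits_injective : Function.Injective bits
  varBits : V → List Bool
  varBits_injective : Function.Injective varBits

namespace Encoding

variable {U L V : Type*} (E : Encoding U L V)

/-- The encoding of an identifier or literal. -/
def term (x : U ⊕ L) : List Symb := (E.bits x).map Symb.bit

/-- The encoding of an identifier. -/
def ident (u : U) : List Symb := E.term (Sum.inl u)

/-- The encoding of a variable. -/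
def var (v : V) : List Symb := (E.varBits v).map Symb.bit

/-- The encoding `⟨ enc(s) , enc(p) , enc(o) ⟩` of a data triple. -/
def triple (t : DataTriple U L) : List Symb :=
  [Symb.langle] ++ E.ident t.subj ++ [Symb.comma] ++ E.ident t.pred ++ [Symb.comma] ++
    E.term t.obj ++ [Symb.rangle]

/-- The encoding `⟪ enc(t₁) , … , enc(tₙ) ⟫` of a finite set of data triples, in increasing
order. -/
noncomputable def triples [LinearOrder U] [LinearOrder L] (T : Finset (DataTriple U L)) :
    List Symb :=
  [Symb.ldangle] ++ [Symb.comma].intercalate ((T.sort (· ≤ ·)).map E.triple) ++ [Symb.rdangle]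

/-- The encoding of a document is the encoding of its data. -/
noncomputable def doc [LinearOrder U] [LinearOrder L] (W : Web U L) (d : W.D) : List Symb :=
  E.triples (W.data d)

/-- The initial part `♯ enc(u₁) enc(adoc(u₁)) ♯ … ♯ enc(uᵢ) enc(adoc(uᵢ)) ♯` of the encoding of
`W`, where `u₁ < … < uᵢ` are the identifiers up to `u` in the domain of `adoc`. -/
noncomputable def webPrefix [LinearOrder U] [LocallyFiniteOrderBot U] [LinearOrder L]
    (W : Web U L) (u : U) : List Symb :=
  [Symb.sharp] ++ ((Finset.Iic u).sort (· ≤ ·)).flatMap fun v =>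
    (W.adoc v).elim [] fun d => E.ident v ++ E.doc W d ++ [Symb.sharp]

open Classical in
/-- The (finite or infinite) word `enc(W)`, as the content of a right-infinite tape; the words
`webPrefix W u` are initial parts of one another, and this is their limit. Blank cells are
`none`. -/
noncomputable def web [LinearOrder U] [LocallyFiniteOrderBot U] [LinearOrder L]
    (W : Web U L) (n : ℕ) : Option Symb :=
  if h : ∃ u, n < (E.webPrefix W u).length then (E.webPrefix W h.choose)[n]? else none

/-- The encoding `⟪ enc(v₁) → enc(μ(v₁)) , … , enc(vₙ) → enc(μ(vₙ)) ⟫` of a valuation, where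
`v₁ < … < vₙ` are the variables in its domain. -/
noncomputable def valuation [LinearOrder V] (μ : Valuation U L V) : List Symb :=
  [Symb.ldangle] ++
    [Symb.comma].intercalate ((μ.finite_dom.toFinset.sort (· ≤ ·)).map fun v =>
      E.var v ++ [Symb.arrow] ++ (μ.toFun v).elim [] E.term) ++
    [Symb.rdangle]

/-- The (finite) word `w` is a possible encoding of the set `Ω` of valuations: the concatenation,
in some order and without repetition, of the encodings of its elements. -/
def IsResult [LinearOrder V] (Ω : Set (Valuation U L V)) (w : List Symb) : Prop :=
  ∃ l : List (Valuation U L V), l.Nodup ∧ (∀ μ, μ ∈ l ↔ μ ∈ Ω) ∧ w = l.flatMap E.valuation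

end Encoding

/-! ## Machine model -/

/-- The tape symbols of a machine: the symbols of encodings and finitely many further symbols `Γ`
of the machine; `none` is the blank. -/
abbrev TapeSymb (Γ : Type) := Option (Symb ⊕ Γ)

/-- What a machine does in one ordinary step: the next state, a move of the head on the read-only
input tape, a symbol to write and a move on the work tape and on the link traversal tape, and
possibly a symbol to append to the output. A move `none` leaves the head where it is. -/
structure Action (Q Γ : Type) where
  next : Q
  inputMove : Option Turing.Dir
  workWrite : TapeSymb Γ
  workMove : Option Turing.Dir
  linkWrite : TapeSymb Γ
  linkMove : Option Turing.Dir
  output : Option Symb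

/-- An LD machine. The transition function sees the state and the symbols under the heads on the
input tape, the work tape and the link traversal tape; the value `none` halts the machine. -/
structure LDMachine where
  Q : Type
  finite_states : Finite Q
  Γ : Type
  finite_symbols : Finite Γ
  start : Q
  expand : Q
  δ : Q → TapeSymb Γ → TapeSymb Γ → TapeSymb Γ → Option (Action Q Γ)

/-- A right-infinite tape with its head. -/
structure RightTape (Γ : Type) where
  cells : ℕ → TapeSymb Γ
  head : ℕ

namespace RightTape

variable {Γ : Type}

/-- The empty tape, with the head on the first cell. -/
def empty : RightTape Γ := ⟨fun _ => none, 0⟩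

/-- The symbol under the head. -/
def read (t : RightTape Γ) : TapeSymb Γ := t.cells t.head

/-- Writing a symbol to the cell under the head. -/
def write (t : RightTape Γ) (a : TapeSymb Γ) : RightTape Γ :=
  ⟨Function.update t.cells t.head a, t.head⟩

/-- Moving the head; on the first cell, a move to the left has no effect. -/
def move (t : RightTape Γ) : Turing.Dir → RightTape Γ
  | Turing.Dir.left => ⟨t.cells, t.head - 1⟩
  | Turing.Dir.right => ⟨t.cells, t.head + 1⟩

/-- The length of the word on the tape: all cells from there on are blank. -/
noncomputable def length (t : RightTape Γ) : ℕ := sInf {n | ∀ m, n ≤ m → t.cells m = none}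

/-- The word on the tape. -/
noncomputable def word (t : RightTape Γ) : List (TapeSymb Γ) := (List.range t.length).map t.cells

/-- Appending a word to the right end of the word on the tape; the head does not move. -/
noncomputable def append (t : RightTape Γ) (w : List Symb) : RightTape Γ :=
  ⟨fun n => if n < t.length then t.cells n else (w[n - t.length]?).map Sum.inl, t.head⟩

end RightTape

/-- The word `w` occurs on the right-infinite tape `tape`. -/
def Occurs (w : List Symb) (tape : ℕ → Option Symb) : Prop :=
  ∃ i, ∀ j < w.length, tape (i + j) = w[j]?

/-- The word `w` ends in the word `x` of binary digits, and `x` is delimited on the left: it is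
either all of `w` or preceded by a symbol that is not a binary digit. -/
def HasBinarySuffix {Γ : Type} (w : List (TapeSymb Γ)) (x : List Symb) : Prop :=
  ∃ w' : List (TapeSymb Γ), w = w' ++ x.map (fun s => some (Sum.inl s)) ∧
    ∀ b, w'.getLast? ≠ some (some (Sum.inl (Symb.bit b)))

open Classical in
/-- The expand procedure, for the content `web` of the Web tape: if the word on the link traversal
tape ends in the encoding of an identifier `u` and the Web tape contains `♯ enc(u) enc(T) ♯` for a
set `T` of data triples (the data of the document `adoc(u)`), then `enc(T) ♯` is appended,
otherwise `♯`. -/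
noncomputable def expandLink {U L V : Type*} [LinearOrder U] [LinearOrder L]
    (E : Encoding U L V) (web : ℕ → Option Symb) {Γ : Type} (t : RightTape Γ) : RightTape Γ :=
  if h : ∃ (T : Finset (DataTriple U L)) (u : U), HasBinarySuffix t.word (E.ident u) ∧
      Occurs ([Symb.sharp] ++ E.ident u ++ E.triples T ++ [Symb.sharp]) web
  then t.append (E.triples h.choose ++ [Symb.sharp])
  else t.append [Symb.sharp]

namespace LDMachine

variable (M : LDMachine)

/-- A configuration of a machine: state, input tape, work tape, link traversal tape, and the word
on the output tape. The Web tape never changes and has no head of its own. -/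
structure Config where
  state : M.Q
  input : Turing.Tape (TapeSymb M.Γ)
  work : Turing.Tape (TapeSymb M.Γ)
  link : RightTape M.Γ
  out : List Symb

/-- The initial configuration, for a word on the ordinary input tape. -/
def init (x : List Symb) : M.Config where
  state := M.start
  input := Turing.Tape.mk₁ (x.map fun s => some (Sum.inl s))
  work := Turing.Tape.mk₁ []
  link := RightTape.empty
  out := []

/-- Performing an action. -/
def perform (c : M.Config) (a : Action M.Q M.Γ) : M.Config where
  state := a.next
  input := a.inputMove.elim c.input fun d => c.input.move d
  work := a.workMove.elim (c.work.write a.workWrite) fun d => (c.work.write a.workWrite).move d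
  link := a.linkMove.elim (c.link.write a.linkWrite) fun d => (c.link.write a.linkWrite).move d
  out := c.out ++ a.output.toList

/-- An ordinary step of a multi-tape Turing machine; `none` if the machine halts. -/
def ordinaryStep (c : M.Config) : Option M.Config :=
  (M.δ c.state c.input.head c.work.head c.link.read).map (M.perform c)

open Classical in
/-- A step with the content `web` on the Web tape. In the expand state the expand procedure takes
place first; the transition function then determines how the machine goes on. -/
noncomputable def step {U L V : Type*} [LinearOrder U] [LinearOrder L] (E : Encoding U L V)
    (web : ℕ → Option Symb) (c : M.Config) : Option M.Config :=
  if c.state = M.expand then M.ordinaryStep { c with link := expandLink E web c.link }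
  else M.ordinaryStep c

end LDMachine

/-- A Linked Data query is finitely computable if there is an LD machine which, for every Web of
Linked Data encoded on the Web tape (and no further input), halts after finitely many steps with a
possible encoding of the query result on the output tape. -/
def FinitelyComputable {U L V : Type*} [LinearOrder U] [LocallyFiniteOrderBot U] [LinearOrder L]
    [LinearOrder V] (E : Encoding U L V) (q : LDQuery U L V) : Prop :=
  ∃ M : LDMachine, ∀ W : Web U L, ∃ c : M.Config,
    Relation.ReflTransGen (fun a b => M.step E (E.web W) a = some b) (M.init []) c ∧
      M.step E (E.web W) c = none ∧ E.IsResult (q W) c.out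

end LinkedData

open Turing

namespace LinkedData

/-! ## Computable functions on one tape -/

/-! With `cNone` no link is ever followed, so the reachable documents are exactly those of the seed
identifiers. With no seeds nothing is reachable under any criterion, so the first claim is the
second one for the empty seed set (`cldQuery_empty_eq`).

The finite sets `S` and `P` can be wired into a machine. It writes the encoding of each seed on the
link traversal tape and calls the expand procedure. Although this procedure is defined by a choice,
its effect is determined, because identifiers are delimited by symbols that are not digits and `♯`
occurs in no identifier or document (`expandLink_linkTape`). Afterwards the tape holds a finite word
with all relevant triples, and the Web tape is no longer needed.

The query result is a computable function of this word. Every variable of `P` occurs in a pattern,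
so a solution takes its values among the components of the triples read, and a finite search finds
all solutions (`valuationValues_mem_answers`, `exists_valuation_of_mem_answers`).

To avoid programming the search on tapes, words are coded as numbers: each symbol is a hexadecimal
digit, after a leading 1 that protects initial zeros. The search is then a primitive recursive
function on `ℕ`, evaluated by a one-tape machine obtained from the compilation of partial recursive
functions (`exists_TM0_of_computable`). As each symbol takes four bits, translating between words
and binary numbers is local. `finitelyComputable_of_lookup` joins lookups, evaluation and output
into one machine. -/

instance : Finite PartrecToTM2.K' :=
  Finite.of_surjective
    (fun i : Fin 4 => match i with
      | 0 => PartrecToTM2.K'.main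
      | 1 => PartrecToTM2.K'.rev
      | 2 => PartrecToTM2.K'.aux
      | 3 => PartrecToTM2.K'.stack)
    (by rintro (_ | _ | _ | _); exacts [⟨0, rfl⟩, ⟨1, rfl⟩, ⟨2, rfl⟩, ⟨3, rfl⟩])

/-- The tape alphabet of the one-tape machines that evaluate partial recursive functions. -/
abbrev StackSymb : Type := TM2to1.Γ' PartrecToTM2.K' fun _ => PartrecToTM2.Γ'

instance : Finite StackSymb :=
  inferInstanceAs (Finite (Bool × (PartrecToTM2.K' → Option PartrecToTM2.Γ')))

/-- A Turing machine can be restricted to a finite set of states that supports it. -/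
theorem exists_finite_TM0 {Γ Λ : Type} [Inhabited Γ] [Inhabited Λ] (M : TM0.Machine Γ Λ)
    (S : Finset Λ) (hS : TM0.Supports M ↑S) :
    ∃ (Q : Type) (_ : Finite Q) (_ : Inhabited Q) (M' : TM0.Machine Γ Q),
      ∀ (l : List Γ) (c : TM0.Cfg Γ Λ), TM0.Reaches M (TM0.init l) c → TM0.step M c = none →
        ∃ q, TM0.Reaches M' (TM0.init l) ⟨q, c.Tape⟩ ∧ TM0.step M' ⟨q, c.Tape⟩ = none := by
  classical
  let instQ : Inhabited {q // q ∈ S} := ⟨⟨default, hS.1⟩⟩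
  -- States outside `S` are collapsed to the start state. This does no harm, since a run from the
  -- start never leaves a supporting set.
  let g₁ : PointedMap Λ {q // q ∈ S} :=
    ⟨fun q => if h : q ∈ S then ⟨q, h⟩ else default, dif_pos hS.1⟩
  let f₁ : PointedMap Γ Γ := ⟨id, rfl⟩
  have hmap : ∀ T : Tape Γ, T.map f₁ = T := by
    intro T
    obtain ⟨L, R, rfl⟩ := T.exists_mk'
    have hL : ∀ L : ListBlank Γ, L.map f₁ = L := fun L => by
      refine ListBlank.ext fun i => ?_
      rw [ListBlank.nth_map]
      rfl
    rw [Tape.map_mk', hL, hL]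
  refine ⟨{q // q ∈ S}, inferInstance, instQ, TM0.Machine.map M f₁ f₁ g₁ Subtype.val, ?_⟩
  have hr := TM0.Machine.map_respects M f₁ f₁ g₁ (Subtype.val) hS (fun _ => rfl)
    (fun q hq => by
      have hq' : q ∈ S := hq
      change (if h : q ∈ S then (⟨q, h⟩ : {q // q ∈ S}) else default).1 = q
      rw [dif_pos hq'])
  intro l c hc hn
  obtain ⟨b, ⟨_, rfl⟩, hb⟩ := StateTransition.tr_reaches hr
    (a₂ := TM0.Cfg.map f₁ g₁ (TM0.init l)) ⟨hS.1, rfl⟩ hc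
  have hb' := hr (a₁ := c) (a₂ := TM0.Cfg.map f₁ g₁ c) ⟨‹_›, rfl⟩
  rw [hn] at hb'
  rw [TM0.map_init, show l.map f₁ = l from List.map_id l] at hb
  refine ⟨g₁ c.q, ?_, ?_⟩
  · rw [← hmap c.Tape]; exact hb
  · rw [← hmap c.Tape]; exact hb'

/-- Every computable function on the natural numbers is computed by a Turing machine with one
tape and finitely many states, in the encodings of Mathlib's stack machines. -/
theorem exists_TM0_of_computable {f : ℕ → ℕ} (hf : Computable f) :
    ∃ (Q : Type) (_ : Finite Q) (_ : Inhabited Q) (M : TM0.Machine StackSymb Q),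
      ∀ n, ∃ q R,
        TM0.Reaches M
          (TM0.init (TM2to1.trInit PartrecToTM2.K'.main (PartrecToTM2.trList [n])))
          ⟨q, Tape.mk' ∅ R⟩ ∧
        TM0.step M ⟨q, Tape.mk' ∅ R⟩ = none ∧
        ∀ i, (R.nth i).2 PartrecToTM2.K'.main = (PartrecToTM2.trList [f n]).reverse[i]? := by
  obtain ⟨c, hc⟩ := ToPartrec.Code.exists_code (Nat.Partrec'.part_iff₁.2 hf.partrec)
  -- The translated machines start in the default state, so the program to be run is made the
  -- default.
  let i₁ : Inhabited PartrecToTM2.Λ' := ⟨PartrecToTM2.trNormal c PartrecToTM2.Cont'.halt⟩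
  let M₁ := TM2to1.tr PartrecToTM2.tr
  let M₀ := TM1to0.tr M₁
  have hS := TM1to0.tr_supports M₁ (TM2to1.tr_supports PartrecToTM2.tr
    (PartrecToTM2.tr_supports c PartrecToTM2.Cont'.halt))
  obtain ⟨Q, hQ, hi, M, hM⟩ := exists_finite_TM0 M₀ _ hS
  refine ⟨Q, hQ, hi, M, fun n => ?_⟩
  have h2 : PartrecToTM2.halt [f n] ∈
      StateTransition.eval (TM2.step PartrecToTM2.tr) (PartrecToTM2.init c [n]) := by
    rw [PartrecToTM2.tr_eval]
    have := hc ⟨[n], rfl⟩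
    simp only [PFun.coe_val, Part.map_eq_map, Part.map_some] at this
    rw [this, Part.map_eq_map, Part.map_some]
    exact Part.mem_some _
  have hinit : PartrecToTM2.init c [n] =
      TM2.init PartrecToTM2.K'.main (PartrecToTM2.trList [n]) := by
    unfold PartrecToTM2.init TM2.init
    congr 1
    funext k
    cases k <;> rfl
  rw [hinit] at h2
  obtain ⟨b, hb, hb'⟩ := StateTransition.tr_eval (TM2to1.tr_respects PartrecToTM2.tr)
    (TM2to1.trCfg_init _ _) h2
  obtain ⟨b₀, hb₀, hb₀'⟩ := StateTransition.tr_eval (TM1to0.tr_respects M₁) rfl hb'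
  obtain ⟨L, hL⟩ := hb
  obtain ⟨hr, hn⟩ := StateTransition.mem_eval.1 hb₀'
  subst hb₀
  obtain ⟨q, hq, hq'⟩ := hM _ _ hr hn
  -- A stack lies on the tape with its bottom under the head, so reading to the right yields it in
  -- reverse.
  refine ⟨q, _, hq, hq', fun i => ?_⟩
  rw [TM2to1.addBottom_nth_snd, TM2to1.stk_nth_val _ (hL PartrecToTM2.K'.main)]
  rfl

/-! ## The word on the Web tape -/

/-- Two words with the same first occurrence of a separator agree up to it. -/
theorem eq_of_append_cons_eq {α : Type*} {p : α → Prop} {x y r s : List α} {a b : α}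
    (hx : ∀ c ∈ x, ¬ p c) (hy : ∀ c ∈ y, ¬ p c) (ha : p a) (hb : p b)
    (h : x ++ a :: r = y ++ b :: s) : x = y ∧ a = b ∧ r = s := by
  induction x generalizing y with
  | nil =>
    cases y with
    | nil => simpa using h
    | cons d y =>
      simp only [List.nil_append, List.cons_append, List.cons.injEq] at h
      exact absurd (h.1 ▸ ha) (hy d (by simp))
  | cons c x ih =>
    cases y with
    | nil =>
      simp only [List.nil_append, List.cons_append, List.cons.injEq] at h
      exact absurd (h.1 ▸ hb) (hx c (by simp))
    | cons d y =>
      simp only [List.cons_append, List.cons.injEq] at h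
      obtain ⟨h1, h2, h3⟩ := ih (fun e he => hx e (by simp [he])) (fun e he => hy e (by simp [he])) h.2
      exact ⟨by rw [h.1, h1], h2, h3⟩

/-- A block between two separators is one of the blocks of which the word consists. -/
theorem mem_of_infix_flatMap {α : Type*} {a : α} {x : List α} (hx : a ∉ x) {l : List (List α)}
    (hl : ∀ y ∈ l, a ∉ y) {r s : List α}
    (h : r ++ a :: (x ++ a :: s) = a :: l.flatMap fun y => y ++ [a]) : x ∈ l := by
  induction l generalizing r with
  | nil =>
    have := congrArg List.length h
    simp at this
    omega
  | cons y l ih =>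
    have hy : a ∉ y := hl y (by simp)
    simp only [List.flatMap_cons, List.append_assoc, List.singleton_append] at h
    cases r with
    | nil =>
      simp only [List.nil_append, List.cons.injEq, true_and] at h
      have := eq_of_append_cons_eq (p := (· = a)) (fun c hc e => hx (e ▸ hc))
        (fun c hc e => hy (e ▸ hc)) rfl rfl h
      simp [this.1]
    | cons b r =>
      simp only [List.cons_append, List.cons.injEq] at h
      obtain ⟨-, h⟩ := h
      -- The opening separator cannot lie inside `y`: it either closes `y`, or comes later and the
      -- induction hypothesis applies.
      rcases List.append_eq_append_iff.1 h with ⟨t, h1, h2⟩ | ⟨t, h1, h2⟩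
      · cases t with
        | nil =>
          exact List.mem_cons_of_mem _ (ih (r := []) (fun z hz => hl z (by simp [hz]))
            (by simpa using h2))
        | cons c t =>
          simp only [List.cons_append, List.cons.injEq] at h2
          exact absurd (by rw [h1, ← h2.1]; simp) hy
      · exact List.mem_cons_of_mem _ (ih (r := t) (fun z hz => hl z (by simp [hz])) h2.symm)

theorem intercalate_cons_cons {α : Type*} (s x y : List α) (l : List (List α)) :
    s.intercalate (x :: y :: l) = x ++ s ++ s.intercalate (y :: l) := by
  simp [List.intercalate]

/-- The symbol is a binary digit. -/
def Symb.IsBit (s : Symb) : Prop := ∃ b, s = Symb.bit b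

namespace Encoding

variable {U L V : Type*} (E : Encoding U L V)

theorem isBit_of_mem_term {x : U ⊕ L} {s : Symb} (h : s ∈ E.term x) : s.IsBit := by
  obtain ⟨b, -, rfl⟩ := List.mem_map.1 h
  exact ⟨b, rfl⟩

theorem term_injective : Function.Injective E.term := fun x y h =>
  E.bits_injective (List.map_injective_iff.2 (fun a b hab => by cases hab; rfl) h)

/-- The part of the encoding of a triple that comes after its first symbol. -/
theorem triple_eq (t : DataTriple U L) :
    E.triple t = Symb.langle :: (E.ident t.subj ++ Symb.comma :: (E.ident t.pred ++
      Symb.comma :: (E.term t.obj ++ [Symb.rangle]))) := by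
  simp [triple]

theorem sharp_notMem_triple (t : DataTriple U L) : Symb.sharp ∉ E.triple t := by
  have h : ∀ x : U ⊕ L, Symb.sharp ∉ E.term x := fun x hx => by
    obtain ⟨b, hb⟩ := E.isBit_of_mem_term hx
    cases hb
  simp [triple_eq, ident, h]

/-- The machine marks the left end of its link traversal tape by an arrow, so no arrow may occur in
what is looked up. -/
theorem arrow_notMem_triple (t : DataTriple U L) : Symb.arrow ∉ E.triple t := by
  have h : ∀ x : U ⊕ L, Symb.arrow ∉ E.term x := fun x hx => by
    obtain ⟨b, hb⟩ := E.isBit_of_mem_term hx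
    cases hb
  simp [triple_eq, ident, h]

variable [LinearOrder U] [LinearOrder L]

theorem notMem_triples {s : Symb} (h1 : s ≠ Symb.ldangle) (h2 : s ≠ Symb.rdangle)
    (h3 : s ≠ Symb.comma) (h4 : ∀ t, s ∉ E.triple t) (T : Finset (DataTriple U L)) :
    s ∉ E.triples T := by
  have : ∀ l : List (List Symb), (∀ x ∈ l, s ∉ x) → s ∉ [Symb.comma].intercalate l := by
    intro l
    induction l with
    | nil => simp
    | cons x l ih =>
      intro hl
      cases l with
      | nil => simpa using hl
      | cons y l =>
        rw [intercalate_cons_cons]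
        simp only [List.mem_append, List.mem_singleton, h3, or_false, not_or]
        exact ⟨hl x (by simp), ih fun z hz => hl z (List.mem_cons_of_mem _ hz)⟩
  simp only [triples, List.mem_append, List.mem_singleton, h1, h2, false_or, or_false]
  refine this _ fun x hx => ?_
  obtain ⟨t, -, rfl⟩ := List.mem_map.1 hx
  exact h4 t

theorem sharp_notMem_triples (T : Finset (DataTriple U L)) : Symb.sharp ∉ E.triples T :=
  E.notMem_triples (by simp) (by simp) (by simp) E.sharp_notMem_triple T

theorem arrow_notMem_triples (T : Finset (DataTriple U L)) : Symb.arrow ∉ E.triples T :=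
  E.notMem_triples (by simp) (by simp) (by simp) E.arrow_notMem_triple T

/-- What the encoding of a Web contains between two consecutive separators. -/
theorem ident_append_triples_inj {u v : U} {T T' : Finset (DataTriple U L)}
    (h : E.ident u ++ E.triples T = E.ident v ++ E.triples T') :
    u = v ∧ E.triples T = E.triples T' := by
  have hn : ∀ x : U ⊕ L, ∀ s ∈ E.term x, ¬ ¬ s.IsBit := fun x s hs hb =>
    hb (E.isBit_of_mem_term hs)
  have h' := eq_of_append_cons_eq (p := fun s => ¬ Symb.IsBit s) (hn _) (hn _)
    (show ¬ Symb.IsBit Symb.ldangle from nofun) (show ¬ Symb.IsBit Symb.ldangle from nofun)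
    (by simpa [triples, ident] using h)
  have hu : u = v := Sum.inl_injective (E.term_injective h'.1)
  subst hu
  exact ⟨rfl, List.append_cancel_left h⟩

/-- What the expand procedure finds for an identifier. -/
noncomputable def response (W : Web U L) (u : U) : List Symb :=
  (W.adoc u).elim [] (E.doc W)

theorem arrow_notMem_response (W : Web U L) (u : U) : Symb.arrow ∉ E.response W u := by
  unfold response
  cases W.adoc u
  · simp
  · exact E.arrow_notMem_triples _

variable [LocallyFiniteOrderBot U]

/-- The missing part is the sorted list of the elements above `u`: the concatenation is sorted and
has the right elements. -/
theorem sort_Iic_prefix {u v : U} (h : u ≤ v) :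
    (Finset.Iic u).sort (· ≤ ·) <+: (Finset.Iic v).sort (· ≤ ·) := by
  refine ⟨((Finset.Iic v).filter (u < ·)).sort (· ≤ ·), ?_⟩
  refine List.Perm.eq_of_pairwise' (r := (· ≤ ·)) ?_ (Finset.pairwise_sort _ _) ?_
  · rw [List.pairwise_append]
    refine ⟨Finset.pairwise_sort _ _, Finset.pairwise_sort _ _, fun a ha b hb => ?_⟩
    simp only [Finset.mem_sort, Finset.mem_Iic, Finset.mem_filter] at ha hb
    exact ha.trans hb.2.le
  · refine (List.perm_ext_iff_of_nodup ?_ (Finset.sort_nodup _ _)).2 fun a => ?_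
    · refine List.Nodup.append (Finset.sort_nodup _ _) (Finset.sort_nodup _ _) ?_
      intro a ha hb
      simp only [Finset.mem_sort, Finset.mem_Iic, Finset.mem_filter] at ha hb
      exact absurd hb.2 (not_lt.2 ha)
    · simp only [List.mem_append, Finset.mem_sort, Finset.mem_Iic, Finset.mem_filter]
      constructor
      · rintro (ha | ha)
        exacts [ha.trans h, ha.1]
      · intro ha
        rcases le_or_gt a u with h' | h'
        exacts [Or.inl h', Or.inr ⟨ha, h'⟩]

theorem webPrefix_prefix (W : Web U L) {u v : U} (h : u ≤ v) :
    E.webPrefix W u <+: E.webPrefix W v := by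
  obtain ⟨r, hr⟩ := sort_Iic_prefix h
  unfold webPrefix
  rw [← hr, List.flatMap_append, ← List.append_assoc]
  exact List.prefix_append _ _

/-- The prefixes extend one another, so any prefix that is long enough gives the same symbol as the
chosen one. -/
theorem web_eq_getElem? (W : Web U L) {n : ℕ} {u : U} (h : n < (E.webPrefix W u).length) :
    E.web W n = (E.webPrefix W u)[n]? := by
  have hex : ∃ u, n < (E.webPrefix W u).length := ⟨u, h⟩
  rw [web, dif_pos hex]
  have h' := hex.choose_spec
  rcases le_total u hex.choose with hle | hle
  · obtain ⟨r, hr⟩ := E.webPrefix_prefix W hle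
    rw [← hr, List.getElem?_append_left h]
  · obtain ⟨r, hr⟩ := E.webPrefix_prefix W hle
    rw [← hr, List.getElem?_append_left h']

theorem exists_of_web_eq_some {W : Web U L} {n : ℕ} {s : Symb} (h : E.web W n = some s) :
    ∃ u, n < (E.webPrefix W u).length := by
  by_contra hn
  rw [web, dif_neg hn] at h
  cases h

/-- This is the shape required by `mem_of_infix_flatMap`: one block per identifier in the domain of
`adoc`, none for the others. -/
theorem webPrefix_eq_flatMap (W : Web U L) (u : U) :
    E.webPrefix W u = Symb.sharp :: (((Finset.Iic u).sort (· ≤ ·)).flatMap fun v =>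
      ((W.adoc v).elim [] fun d => [E.ident v ++ E.doc W d])).flatMap fun y =>
        y ++ [Symb.sharp] := by
  rw [webPrefix, List.flatMap_assoc, List.singleton_append]
  congr 2
  funext v
  cases W.adoc v <;> simp

/-- The occurrence lies in a finite prefix of the Web tape. What stands between its two `♯` contains
no `♯`, hence is one whole block, and a block splits uniquely at its first symbol that is not a
digit. Only the encodings of the documents are compared, so `T` itself need not be recovered. -/
theorem eq_of_occurs {W : Web U L} {u : U} {T : Finset (DataTriple U L)}
    (h : Occurs ([Symb.sharp] ++ E.ident u ++ E.triples T ++ [Symb.sharp]) (E.web W)) :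
    ∃ d, W.adoc u = some d ∧ E.triples T = E.doc W d := by
  obtain ⟨i, hi⟩ := h
  set w := [Symb.sharp] ++ E.ident u ++ E.triples T ++ [Symb.sharp] with hw
  have hlen : 0 < w.length := by simp [hw]
  -- The last cell of the occurrence is not blank, so some prefix reaches that far.
  have hlast := hi (w.length - 1) (by omega)
  rw [List.getElem?_eq_getElem (by omega)] at hlast
  obtain ⟨v, hv⟩ := E.exists_of_web_eq_some hlast
  have hinf : w = ((E.webPrefix W v).drop i).take w.length := by
    refine List.ext_getElem? fun j => ?_
    rcases lt_or_ge j w.length with hj | hj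
    · rw [List.getElem?_take_of_lt hj, List.getElem?_drop, ← hi j hj]
      exact E.web_eq_getElem? W (by omega)
    · rw [List.getElem?_eq_none hj, List.getElem?_eq_none (by simp; omega)]
  have hsplit : E.webPrefix W v = (E.webPrefix W v).take i ++ (w ++
      ((E.webPrefix W v).drop i).drop w.length) := by
    conv_lhs => rw [← List.take_append_drop i (E.webPrefix W v),
      ← List.take_append_drop w.length ((E.webPrefix W v).drop i), ← hinf]
  have hsh : ∀ x : U ⊕ L, Symb.sharp ∉ E.term x := fun x hx => by
    obtain ⟨b, hb⟩ := E.isBit_of_mem_term hx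
    cases hb
  have hmem := mem_of_infix_flatMap (a := Symb.sharp) (x := E.ident u ++ E.triples T)
    (r := (E.webPrefix W v).take i) (s := ((E.webPrefix W v).drop i).drop w.length)
    (l := ((Finset.Iic v).sort (· ≤ ·)).flatMap fun v =>
      ((W.adoc v).elim [] fun d => [E.ident v ++ E.doc W d]))
    (by simp [ident, hsh, sharp_notMem_triples])
    (by
      intro y hy
      obtain ⟨v, -, hv⟩ := List.mem_flatMap.1 hy
      cases hd : W.adoc v with
      | none => simp [hd] at hv
      | some d =>
        simp only [hd, Option.elim_some, List.mem_singleton] at hv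
        subst hv
        simp [ident, hsh, doc, sharp_notMem_triples])
    (by rw [← E.webPrefix_eq_flatMap]; conv_rhs => rw [hsplit]
        simp [hw])
  obtain ⟨v, -, hv⟩ := List.mem_flatMap.1 hmem
  cases hd : W.adoc v with
  | none => simp [hd] at hv
  | some d =>
    simp only [hd, Option.elim_some, List.mem_singleton] at hv
    obtain ⟨rfl, h2⟩ := E.ident_append_triples_inj hv
    exact ⟨d, hd, h2⟩

theorem occurs_of_adoc {W : Web U L} {u : U} {d : W.D} (h : W.adoc u = some d) :
    Occurs ([Symb.sharp] ++ E.ident u ++ E.doc W d ++ [Symb.sharp]) (E.web W) := by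
  have hmem : u ∈ (Finset.Iic u).sort (· ≤ ·) := by simp
  obtain ⟨l₁, l₂, hl⟩ := List.append_of_mem hmem
  -- The `♯` in front of the block of `u` is the one that closes the preceding block, or the initial
  -- one.
  have hsharp : ∀ l : List (List Symb), ∃ r,
      Symb.sharp :: (l.flatMap fun y => y ++ [Symb.sharp]) = r ++ [Symb.sharp] := by
    intro l
    induction l using List.reverseRecOn with
    | nil => exact ⟨[], rfl⟩
    | append_singleton l y _ =>
      exact ⟨Symb.sharp :: ((l.flatMap fun y => y ++ [Symb.sharp]) ++ y), by simp⟩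
  obtain ⟨r, hr⟩ := hsharp (l₁.flatMap fun v =>
      ((W.adoc v).elim [] fun d => [E.ident v ++ E.doc W d]))
  obtain ⟨s, hs⟩ : ∃ s, E.webPrefix W u =
      r ++ (([Symb.sharp] ++ E.ident u ++ E.doc W d ++ [Symb.sharp]) ++ s) := by
    rw [webPrefix_eq_flatMap, hl, List.flatMap_append, List.flatMap_append, ← List.cons_append, hr]
    simp only [List.flatMap_cons, h, Option.elim_some]
    exact ⟨_, by simp only [List.flatMap_append, List.flatMap_cons, List.flatMap_nil,
      List.append_assoc, List.append_nil]; rfl⟩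
  refine ⟨r.length, fun j hj => ?_⟩
  rw [E.web_eq_getElem? W (u := u) (by rw [hs]; simp only [List.length_append] at hj ⊢; omega), hs,
    List.getElem?_append_right (by omega), Nat.add_sub_cancel_left, List.getElem?_append_left hj]

end Encoding

/-! ## The link traversal tape -/

/-- The right-infinite tape that contains a word of encoding symbols. -/
def linkTape {Γ : Type} (w : List Symb) (h : ℕ) : RightTape Γ :=
  ⟨fun n => (w[n]?).map Sum.inl, h⟩

section linkTape

variable {Γ : Type}

theorem linkTape_nil : (linkTape [] 0 : RightTape Γ) = RightTape.empty := by
  simp [linkTape, RightTape.empty]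

theorem linkTape_length (w : List Symb) (h : ℕ) : (linkTape w h : RightTape Γ).length = w.length := by
  unfold RightTape.length
  refine le_antisymm (Nat.sInf_le ?_) (le_csInf ⟨w.length, ?_⟩ fun n hn => ?_)
  · intro m hm
    simp [linkTape, hm]
  · intro m hm
    simp [linkTape, hm]
  · by_contra hlt
    have := hn n le_rfl
    simp [linkTape] at this
    omega

theorem linkTape_word (w : List Symb) (h : ℕ) :
    (linkTape w h : RightTape Γ).word = w.map fun s => some (Sum.inl s) := by
  unfold RightTape.word
  rw [linkTape_length]
  refine List.ext_getElem (by simp) fun n h1 h2 => ?_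
  simp at h2
  simp [linkTape, h2]

theorem linkTape_append (w v : List Symb) (h : ℕ) :
    (linkTape w h : RightTape Γ).append v = linkTape (w ++ v) h := by
  unfold RightTape.append
  rw [linkTape_length]
  simp only [linkTape, RightTape.mk.injEq, and_true]
  funext n
  split_ifs with hn
  · rw [List.getElem?_append_left hn]
  · rw [List.getElem?_append_right (by omega)]

theorem linkTape_read (w : List Symb) (h : ℕ) :
    (linkTape w h : RightTape Γ).read = (w[h]?).map Sum.inl := rfl

theorem RightTape.write_read (t : RightTape Γ) : t.write t.read = t := by
  simp [RightTape.write, RightTape.read]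

theorem linkTape_write (w : List Symb) (s : Symb) :
    (linkTape w w.length : RightTape Γ).write (some (Sum.inl s)) =
      linkTape (w ++ [s]) w.length := by
  simp only [linkTape, RightTape.write, RightTape.mk.injEq, and_true]
  funext n
  rcases lt_trichotomy n w.length with h | h | h
  · rw [Function.update_of_ne h.ne, List.getElem?_append_left h]
  · subst h
    simp
  · rw [Function.update_of_ne h.ne', List.getElem?_eq_none (by omega),
      List.getElem?_eq_none (by simp; omega)]

variable {U L V : Type*} (E : Encoding U L V)

/-- Read from the right, both decompositions break at the first symbol that is not a digit, so the
two identifier encodings coincide. -/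
theorem hasBinarySuffix_ident_iff {w : List Symb} {s : Symb} (hs : ¬ s.IsBit) {u v : U} :
    HasBinarySuffix (Γ := Γ) ((w ++ [s] ++ E.ident u).map fun s => some (Sum.inl s))
      (E.ident v) ↔ v = u := by
  constructor
  · rintro ⟨w', hw', hlast⟩
    have h1 := congrArg List.reverse hw'
    have hinj : Function.Injective fun s : Symb => (some (Sum.inl s) : TapeSymb Γ) :=
      fun a b h => by simpa using h
    let p : TapeSymb Γ → Prop := fun a => ¬ ∃ b, a = some (Sum.inl (Symb.bit b))
    have hn : ∀ x : U, ∀ a ∈ ((E.ident x).map fun s => (some (Sum.inl s) : TapeSymb Γ)).reverse,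
        ¬ p a := by
      intro x a ha hp
      simp only [List.mem_reverse, List.mem_map] at ha
      obtain ⟨c, hc, rfl⟩ := ha
      obtain ⟨b, rfl⟩ := E.isBit_of_mem_term hc
      exact hp ⟨b, rfl⟩
    have hps : p (some (Sum.inl s)) := by
      rintro ⟨b, hb⟩
      exact hs ⟨b, by simpa using hb⟩
    rcases List.eq_nil_or_concat' w' with rfl | ⟨w'', a, rfl⟩
    · exfalso
      have hmem : (some (Sum.inl s) : TapeSymb Γ) ∈
          ((E.ident v).map fun s => (some (Sum.inl s) : TapeSymb Γ)).reverse := by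
        rw [List.nil_append] at h1
        rw [← h1]
        simp
      exact hn _ _ hmem hps
    · have hpa : p a := by
        rintro ⟨b, rfl⟩
        exact hlast b (by simp)
      have h2 := eq_of_append_cons_eq (p := p) (hn u) (hn v) hps hpa (by simpa using h1)
      have h3 := List.reverse_injective h2.1
      exact (Sum.inl_injective (E.term_injective (List.map_injective_iff.2 hinj h3))).symm
  · rintro rfl
    refine ⟨(w ++ [s]).map fun s => some (Sum.inl s), by simp, fun b hb => hs ⟨b, ?_⟩⟩
    simpa using hb

/-- The choice in `expandLink` is immaterial: the delimiter `s` determines the identifier, and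
`eq_of_occurs` then determines the encoding that is appended. -/
theorem expandLink_linkTape [LinearOrder U] [LinearOrder L] [LocallyFiniteOrderBot U]
    (W : Web U L) (w : List Symb) {s : Symb} (hs : ¬ s.IsBit) (u : U)
    (h : ℕ) :
    expandLink E (E.web W) (linkTape (w ++ [s] ++ E.ident u) h : RightTape Γ) =
      linkTape (w ++ [s] ++ E.ident u ++ E.response W u ++ [Symb.sharp]) h := by
  unfold expandLink
  split_ifs with hex
  · obtain ⟨v, hv, hocc⟩ := hex.choose_spec
    rw [linkTape_word, hasBinarySuffix_ident_iff E hs] at hv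
    subst hv
    obtain ⟨d, hd, ht⟩ := E.eq_of_occurs hocc
    rw [linkTape_append, ht, Encoding.response, hd]
    simp
  · cases hd : W.adoc u with
    | none => simp [linkTape_append, Encoding.response, hd]
    | some d =>
      refine absurd ⟨W.data d, u, ?_, E.occurs_of_adoc hd⟩ hex
      rw [linkTape_word, hasBinarySuffix_ident_iff E hs]

end linkTape

/-! ## Symbols as digits -/

/-- A number below 16 for each symbol; those of the binary digits are 0 and 1. -/
def Symb.digit : Symb → ℕ
  | bit b => b.toNat
  | sharp => 2
  | langle => 3
  | rangle => 4
  | ldangle => 5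
  | rdangle => 6
  | comma => 7
  | arrow => 8

/-- The symbol with a given digit. -/
def Symb.ofDigit : ℕ → Symb
  | 0 => bit false
  | 1 => bit true
  | 2 => sharp
  | 3 => langle
  | 4 => rangle
  | 5 => ldangle
  | 6 => rdangle
  | 7 => comma
  | _ => arrow

theorem Symb.ofDigit_digit (s : Symb) : Symb.ofDigit s.digit = s := by
  rcases s with (_ | _) | _ | _ | _ | _ | _ | _ | _ <;> rfl

theorem Symb.digit_lt (s : Symb) : s.digit < 16 := by
  rcases s with (_ | _) | _ | _ | _ | _ | _ | _ | _ <;> decide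

/-- The number whose hexadecimal digits are a leading 1 and those of a list. -/
def digitsNum (l : List ℕ) : ℕ := l.foldl (fun n d => 16 * n + d) 1

/-- A binary digit on a stack. -/
def bitSymb (b : Bool) : PartrecToTM2.Γ' := cond b PartrecToTM2.Γ'.bit1 PartrecToTM2.Γ'.bit0

/-- The four binary digits of a number below 16. -/
def digitBits (d : ℕ) : List PartrecToTM2.Γ' :=
  [bitSymb (d.testBit 3), bitSymb (d.testBit 2), bitSymb (d.testBit 1), bitSymb (d.testBit 0)]

theorem digitsNum_pos (l : List ℕ) : 0 < digitsNum l := by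
  induction l using List.reverseRecOn with
  | nil => exact Nat.one_pos
  | append_singleton l d ih =>
    simp only [digitsNum, List.foldl_append, List.foldl_cons, List.foldl_nil] at ih ⊢
    omega

/-- Binary numbers are stored least significant bit first, and zero as the empty list. Positivity
excludes a zero bit added to zero, where the equation fails. -/
theorem trNat_bit (b : Bool) {n : ℕ} (hn : 0 < n) :
    PartrecToTM2.trNat (2 * n + b.toNat) = bitSymb b :: PartrecToTM2.trNat n := by
  unfold PartrecToTM2.trNat
  have h : ((2 * n + b.toNat : ℕ) : Num) = Num.ofNat' (Nat.bit b n) := by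
    rw [Nat.bit_val, ← Num.ofNat'_eq]
  rw [h, Num.ofNat'_bit, Num.ofNat'_eq]
  cases hm : (n : Num) with
  | zero =>
    exfalso
    have := congrArg (fun m : Num => (m : ℕ)) hm
    simp at this
    omega
  | pos m => cases b <;> rfl

theorem trNat_digit {d n : ℕ} (hd : d < 16) (hn : 0 < n) :
    PartrecToTM2.trNat (16 * n + d) = (digitBits d).reverse ++ PartrecToTM2.trNat n := by
  have hsum : d = 8 * (d.testBit 3).toNat + 4 * (d.testBit 2).toNat + 2 * (d.testBit 1).toNat +
      (d.testBit 0).toNat := by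
    revert hd d
    decide
  have e : 16 * n + d = 2 * (2 * (2 * (2 * n + (d.testBit 3).toNat) + (d.testBit 2).toNat) +
      (d.testBit 1).toNat) + (d.testBit 0).toNat := by omega
  rw [e, trNat_bit _ (by omega), trNat_bit _ (by omega), trNat_bit _ (by omega), trNat_bit _ hn]
  rfl

/-- Stacks are laid out on the tape in reverse, so the number appears as the leading 1 and then four
bits per symbol, in the order of the word. -/
theorem trNat_digitsNum {l : List ℕ} (hl : ∀ d ∈ l, d < 16) :
    (PartrecToTM2.trNat (digitsNum l)).reverse =
      PartrecToTM2.Γ'.bit1 :: l.flatMap digitBits := by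
  induction l using List.reverseRecOn with
  | nil => rfl
  | append_singleton l d ih =>
    have e : digitsNum (l ++ [d]) = 16 * digitsNum l + d := by simp [digitsNum]
    rw [e, trNat_digit (hl d (by simp)) (digitsNum_pos l), List.reverse_append,
      List.reverse_reverse, ih fun d hd => hl d (by simp [hd])]
    simp

/-! ## A machine that collects documents and then evaluates a function -/

/-- The commands of the first phase: write a symbol to the end of the link traversal tape, call
the expand procedure, and move to the end of the link traversal tape. -/
inductive SeedCmd
  | put (s : Symb)
  | expand
  | seek

/-- The states of the machine: positions in the commands of the first phase, the expand state, the
states that copy the word on the link traversal tape to the work tape in binary, the states of the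
evaluating machine, and the states that read off the result. -/
inductive PipeState (n : ℕ) (Q : Type)
  | cmd (p : Fin (n + 1))
  | expand
  | copy (i : Fin 4)
  | bottom
  | run (q : Q)
  | out (acc : Fin 16)

instance {n : ℕ} {Q : Type} [Finite Q] : Finite (PipeState n Q) := by
  refine Finite.of_injective
    (β := (Fin (n + 1) ⊕ Fin 4) ⊕ (Q ⊕ Fin 16) ⊕ Bool)
    (fun s => match s with
      | .cmd p => Sum.inl (Sum.inl p)
      | .copy i => Sum.inl (Sum.inr i)
      | .run q => Sum.inr (Sum.inl (Sum.inl q))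
      | .out a => Sum.inr (Sum.inl (Sum.inr a))
      | .expand => Sum.inr (Sum.inr true)
      | .bottom => Sum.inr (Sum.inr false)) ?_
  rintro (_ | _ | _ | _ | _ | _) (_ | _ | _ | _ | _ | _) h <;> simp_all

/-- The further tape symbols of the machine: return positions, and the alphabet of the evaluating
machine. -/
abbrev PipeSymb (n : ℕ) : Type := Fin (n + 1) ⊕ StackSymb

/-- The symbol of the evaluating machine that a cell of the work tape stands for. -/
def pipeRead (n : ℕ) : PointedMap (TapeSymb (PipeSymb n)) StackSymb :=
  ⟨fun a => match a with
    | some (Sum.inr (Sum.inr s)) => s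
    | _ => default, rfl⟩

/-- The symbol for the one-element stack `main` at a cell. -/
def stackSymb (mark : Bool) (a : PartrecToTM2.Γ') : StackSymb :=
  (mark, Function.update (fun _ => none) PartrecToTM2.K'.main (some a))

/-- The action that moves only the link traversal head. -/
def pipeAct {n : ℕ} {Q : Type} (work link : TapeSymb (PipeSymb n)) (q : PipeState n Q)
    (linkMove : Option Dir) : Action (PipeState n Q) (PipeSymb n) where
  next := q
  inputMove := none
  workWrite := work
  workMove := none
  linkWrite := link
  linkMove := linkMove
  output := none

/-- The transition function of the machine. -/
def pipeStep (cmds : List SeedCmd) {Q : Type} [Inhabited Q] (M : TM0.Machine StackSymb Q)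
    (q : PipeState cmds.length Q) (work link : TapeSymb (PipeSymb cmds.length)) :
    Option (Action (PipeState cmds.length Q) (PipeSymb cmds.length)) :=
  match q with
  | .cmd p =>
    match cmds[p.val]? with
    | some (.put s) =>
      some (pipeAct work (some (Sum.inl s)) (.cmd (Fin.ofNat _ (p + 1))) (some Dir.right))
    | some .expand =>
      some (pipeAct (some (Sum.inr (Sum.inl (Fin.ofNat _ (p + 1))))) link .expand none)
    | some .seek =>
      match link with
      | none => some (pipeAct work link (.cmd (Fin.ofNat _ (p + 1))) none)
      | some _ => some (pipeAct work link (.cmd p) (some Dir.right))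
    -- The head is one cell past the word; the left move brings it to the last symbol.
    | none => some (pipeAct work link (.copy 0) (some Dir.left))
  -- There is only one expand state, so the position to return to is handed over on the work tape.
  | .expand =>
    match work with
    | some (Sum.inr (Sum.inl p)) => some (pipeAct work link (.cmd p) none)
    | _ => none
  | .copy i =>
    match link with
    -- The arrow in the first cell ends the copying; the leading 1 of `digitsNum` takes its place.
    | some (Sum.inl Symb.arrow) =>
      some { pipeAct (some (Sum.inr (Sum.inr (stackSymb false (bitSymb true))))) link .bottom
              none with workMove := some Dir.left }
    | some (Sum.inl s) =>
      some { pipeAct (some (Sum.inr (Sum.inr (stackSymb false (bitSymb (s.digit.testBit i))))))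
              link (.copy (i + 1)) (if i = 3 then some Dir.left else none) with
              workMove := some Dir.left }
    | _ => none
  | .bottom =>
    some (pipeAct (some (Sum.inr (Sum.inr (stackSymb true PartrecToTM2.Γ'.cons)))) link
      (.run default) none)
  | .run q =>
    match M q (pipeRead _ work) with
    | some (q', TM0.Stmt.move d) =>
      some { pipeAct work link (.run q') none with workMove := some d }
    | some (q', TM0.Stmt.write a) =>
      some (pipeAct (some (Sum.inr (Sum.inr a))) link (.run q') none)
    -- The evaluation halts with the head on the bottom cell, which holds the terminator `cons`; the
    -- right move skips it.
    | none => some { pipeAct work link (.out 0) none with workMove := some Dir.right }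
  | .out acc =>
    match (pipeRead _ work).2 PartrecToTM2.K'.main with
    | some a =>
      -- The accumulator is a 1 followed by the bits read of the current digit, so exactly the
      -- fourth bit takes it to 16 or more. Started at 0, it becomes 1 by reading the leading 1 of
      -- the number.
      let m := 2 * acc.val + (if a = PartrecToTM2.Γ'.bit1 then 1 else 0)
      if 16 ≤ m then
        some { pipeAct work link (.out 1) none with
                workMove := some Dir.right
                output := some (Symb.ofDigit (m - 16)) }
      else some { pipeAct work link (.out (Fin.ofNat _ m)) none with workMove := some Dir.right }
    | none => none

/-- The machine that performs the given commands, computes a function of the word on the link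
traversal tape by a machine with one tape, and writes the result to the output tape. -/
def pipeMachine (cmds : List SeedCmd) {Q : Type} [Finite Q] [Inhabited Q]
    (M : TM0.Machine StackSymb Q) : LDMachine where
  Q := PipeState cmds.length Q
  finite_states := inferInstance
  Γ := PipeSymb cmds.length
  finite_symbols := inferInstance
  start := .cmd (Fin.ofNat _ 0)
  expand := .expand
  δ q _ work link := pipeStep cmds M q work link

section Run

variable {U L V : Type*} [LinearOrder U] [LinearOrder L] (E : Encoding U L V)
  (web : ℕ → Option Symb) (cmds : List SeedCmd) {Q : Type} [Finite Q] [Inhabited Q]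
  (M : TM0.Machine StackSymb Q)

/-- A configuration of the machine. -/
def pipeCfg (q : PipeState cmds.length Q) (T : Tape (TapeSymb (PipeSymb cmds.length)))
    (w : List Symb) (h : ℕ) (o : List Symb) : (pipeMachine cmds M).Config where
  state := q
  input := Tape.mk₁ []
  work := T
  link := linkTape w h
  out := o

/-- A finite number of steps of the machine. -/
def PipeReaches (a b : (pipeMachine cmds M).Config) : Prop :=
  Relation.ReflTransGen (fun a b => (pipeMachine cmds M).step E web a = some b) a b

variable {E web cmds M}

theorem PipeReaches.single {a b : (pipeMachine cmds M).Config}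
    (h : (pipeMachine cmds M).step E web a = some b) : PipeReaches E web cmds M a b :=
  Relation.ReflTransGen.single h

theorem PipeReaches.trans {a b c : (pipeMachine cmds M).Config}
    (h : PipeReaches E web cmds M a b) (h' : PipeReaches E web cmds M b c) :
    PipeReaches E web cmds M a c :=
  Relation.ReflTransGen.trans h h'

theorem PipeReaches.tail {a b c : (pipeMachine cmds M).Config}
    (h : PipeReaches E web cmds M a b) (h' : (pipeMachine cmds M).step E web b = some c) :
    PipeReaches E web cmds M a c :=
  Relation.ReflTransGen.tail h h'

variable (E web)

/-- The position of a head on a right-infinite tape after a possible move. -/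
def moveHead (d : Option Dir) (h : ℕ) : ℕ :=
  match d with
  | none => h
  | some Dir.left => h - 1
  | some Dir.right => h + 1

/-- Covers every action except writing a new symbol in the first phase: putting back the symbol just
read leaves the link traversal tape unchanged. -/
theorem perform_pipeCfg (q q' : PipeState cmds.length Q)
    (T : Tape (TapeSymb (PipeSymb cmds.length))) (w : List Symb) (h : ℕ) (o : List Symb)
    (ww : TapeSymb (PipeSymb cmds.length)) (wm lm : Option Dir) (x : Option Symb) :
    (pipeMachine cmds M).perform (pipeCfg cmds M q T w h o)
      ({ next := q', inputMove := none, workWrite := ww, workMove := wm,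
         linkWrite := (w[h]?).map Sum.inl, linkMove := lm, output := x } : Action _ _) =
      pipeCfg cmds M q' (wm.elim (T.write ww) fun d => (T.write ww).move d) w
        (moveHead lm h) (o ++ x.toList) := by
  have h' := RightTape.write_read (linkTape w h : RightTape (PipeSymb cmds.length))
  simp only [LDMachine.perform, pipeCfg, ← linkTape_read (Γ := PipeSymb cmds.length)]
  congr 1
  rcases lm with _ | _ | _
  · exact h'
  · exact congrArg (fun t => RightTape.move t Dir.left) h'
  · exact congrArg (fun t => RightTape.move t Dir.right) h'

theorem step_pipeCfg {q q' : PipeState cmds.length Q} (hq : q ≠ .expand)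
    {T : Tape (TapeSymb (PipeSymb cmds.length))} {w : List Symb} {h : ℕ}
    {ww : TapeSymb (PipeSymb cmds.length)} {wm lm : Option Dir} {x : Option Symb}
    (hs : pipeStep cmds M q T.head ((w[h]?).map Sum.inl) =
      some { next := q', inputMove := none, workWrite := ww, workMove := wm,
             linkWrite := (w[h]?).map Sum.inl, linkMove := lm, output := x }) (o : List Symb) :
    (pipeMachine cmds M).step E web (pipeCfg cmds M q T w h o) =
      some (pipeCfg cmds M q' (wm.elim (T.write ww) fun d => (T.write ww).move d) w
        (moveHead lm h) (o ++ x.toList)) := by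
  refine (if_neg hq).trans ?_
  refine (congrArg (Option.map _) hs).trans ?_
  exact congrArg some (perform_pipeCfg ..)

/-- The transition function sees the word `w'` after the expand procedure, while the head is still
where it was before. -/
theorem step_pipeCfg_expand {q' : PipeState cmds.length Q}
    {T : Tape (TapeSymb (PipeSymb cmds.length))} {w w' : List Symb} {h : ℕ}
    (hw' : expandLink E web (linkTape w h : RightTape (PipeSymb cmds.length)) = linkTape w' h)
    {ww : TapeSymb (PipeSymb cmds.length)} {wm lm : Option Dir} {x : Option Symb}
    (hs : pipeStep cmds M .expand T.head ((w'[h]?).map Sum.inl) =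
      some { next := q', inputMove := none, workWrite := ww, workMove := wm,
             linkWrite := (w'[h]?).map Sum.inl, linkMove := lm, output := x }) (o : List Symb) :
    (pipeMachine cmds M).step E web (pipeCfg cmds M .expand T w h o) =
      some (pipeCfg cmds M q' (wm.elim (T.write ww) fun d => (T.write ww).move d) w'
        (moveHead lm h) (o ++ x.toList)) := by
  refine (if_pos rfl).trans ?_
  have : ({ pipeCfg cmds M .expand T w h o with
      link := expandLink E web (pipeCfg cmds M .expand T w h o).link } :
      (pipeMachine cmds M).Config) = pipeCfg cmds M .expand T w' h o :=
    congrArg (fun t => ({ pipeCfg cmds M .expand T w h o with link := t } :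
      (pipeMachine cmds M).Config)) hw'
  rw [this]
  refine (congrArg (Option.map _) hs).trans ?_
  exact congrArg some (perform_pipeCfg ..)

/-! ### The first phase -/

theorem reaches_put {p : ℕ} {s : Symb} (hp : cmds[p]? = some (.put s))
    (T : Tape (TapeSymb (PipeSymb cmds.length))) (w : List Symb) (o : List Symb) :
    PipeReaches E web cmds M (pipeCfg cmds M (.cmd (Fin.ofNat _ p)) T w w.length o)
      (pipeCfg cmds M (.cmd (Fin.ofNat _ (p + 1))) T (w ++ [s]) (w ++ [s]).length o) := by
  have hlt : p < cmds.length := (List.getElem?_eq_some_iff.1 hp).1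
  have hv : (Fin.ofNat (cmds.length + 1) p).val = p := Nat.mod_eq_of_lt (by omega)
  have hq : (.cmd (Fin.ofNat _ p) : PipeState cmds.length Q) ≠ .expand := by simp
  refine Relation.ReflTransGen.single ((if_neg hq).trans ?_)
  have hs : pipeStep cmds M (.cmd (Fin.ofNat _ p)) T.head ((w[w.length]?).map Sum.inl) =
      some (pipeAct T.head (some (Sum.inl s)) (.cmd (Fin.ofNat _ (p + 1))) (some Dir.right)) := by
    simp only [pipeStep, hv, hp]
  refine (congrArg (Option.map _) hs).trans ?_
  have ht : ((linkTape w w.length : RightTape (PipeSymb cmds.length)).write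
      (some (Sum.inl s))).move Dir.right = linkTape (w ++ [s]) (w ++ [s]).length := by
    rw [linkTape_write]
    simp [linkTape, RightTape.move]
  refine congrArg some ?_
  unfold LDMachine.perform pipeCfg
  congr 1
  exact List.append_nil _

theorem reaches_puts (x : List Symb) {pre post : List SeedCmd}
    (hc : cmds = pre ++ (x.map SeedCmd.put ++ post))
    (T : Tape (TapeSymb (PipeSymb cmds.length))) (w : List Symb) (o : List Symb) :
    PipeReaches E web cmds M (pipeCfg cmds M (.cmd (Fin.ofNat _ pre.length)) T w w.length o)
      (pipeCfg cmds M (.cmd (Fin.ofNat _ (pre.length + x.length))) T (w ++ x)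
        (w ++ x).length o) := by
  induction x generalizing pre w with
  | nil =>
    simp only [List.length_nil, Nat.add_zero, List.append_nil]
    exact Relation.ReflTransGen.refl
  | cons s x ih =>
    refine Relation.ReflTransGen.trans (reaches_put E web (s := s) ?_ T w o) ?_
    · conv_lhs => rw [hc]
      simp
    · have := ih (pre := pre ++ [SeedCmd.put s]) (by rw [hc]; simp) (w ++ [s])
      rw [List.length_append, List.length_singleton, List.append_assoc, List.singleton_append]
        at this
      rwa [List.length_cons, ← Nat.add_assoc, Nat.add_right_comm]

/-- Needed because the expand procedure appends without moving the head; the induction is on the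
distance to the end of the word. -/
theorem reaches_seek {p : ℕ} (hp : cmds[p]? = some .seek)
    (T : Tape (TapeSymb (PipeSymb cmds.length))) (w : List Symb) (o : List Symb) (h : ℕ)
    (hh : h ≤ w.length) :
    PipeReaches E web cmds M (pipeCfg cmds M (.cmd (Fin.ofNat _ p)) T w h o)
      (pipeCfg cmds M (.cmd (Fin.ofNat _ (p + 1))) T w w.length o) := by
  have hlt : p < cmds.length := (List.getElem?_eq_some_iff.1 hp).1
  have hv : (Fin.ofNat (cmds.length + 1) p).val = p := Nat.mod_eq_of_lt (by omega)
  induction hk : w.length - h generalizing h with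
  | zero =>
    obtain rfl : h = w.length := by omega
    refine Relation.ReflTransGen.single ?_
    have hn : w[w.length]? = none := by simp
    refine (step_pipeCfg E web (q' := .cmd (Fin.ofNat _ (p + 1))) (ww := T.head) (wm := none)
      (lm := none) (x := none) (by simp)
      (by simp only [pipeStep, hv, hp, hn, Option.map_none, pipeAct]) o).trans ?_
    simp [Tape.write_self, moveHead]
  | succ k ih =>
    have hn : w[h]? = some w[h] := by simp
    refine Relation.ReflTransGen.head ?_ (ih (h + 1) (by omega) (by omega))
    refine (step_pipeCfg E web (q' := .cmd (Fin.ofNat _ p)) (ww := T.head) (wm := none)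
      (lm := some Dir.right) (x := none) (by simp)
      (by simp only [pipeStep, hv, hp, hn, Option.map_some, pipeAct]) o).trans ?_
    simp [Tape.write_self, moveHead]

/-- The work tape is blank, apart from return positions. -/
def IsBlank {n : ℕ} (T : Tape (TapeSymb (PipeSymb n))) : Prop :=
  T.map (pipeRead n) = Tape.mk' ∅ ∅

/-- The return position stays behind on the work tape, but `pipeRead` reads it as a blank. Hence
blankness is only tracked up to `pipeRead`. -/
theorem reaches_expand {p : ℕ} (hp : cmds[p]? = some .expand)
    {T : Tape (TapeSymb (PipeSymb cmds.length))} (hT : IsBlank T) (w : List Symb) (h : ℕ)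
    (o : List Symb) {w' : List Symb} (hw' : expandLink E web
      (linkTape w h : RightTape (PipeSymb cmds.length)) = linkTape w' h) :
    ∃ T', IsBlank T' ∧
      PipeReaches E web cmds M (pipeCfg cmds M (.cmd (Fin.ofNat _ p)) T w h o)
        (pipeCfg cmds M (.cmd (Fin.ofNat _ (p + 1))) T' w' h o) := by
  have hlt : p < cmds.length := (List.getElem?_eq_some_iff.1 hp).1
  have hv : (Fin.ofNat (cmds.length + 1) p).val = p := Nat.mod_eq_of_lt (by omega)
  refine ⟨T.write (some (Sum.inr (Sum.inl (Fin.ofNat _ (p + 1))))), ?_, ?_⟩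
  · unfold IsBlank at hT ⊢
    rw [Tape.map_write, hT]
    rfl
  · refine Relation.ReflTransGen.head (b := pipeCfg cmds M .expand
      (T.write (some (Sum.inr (Sum.inl (Fin.ofNat _ (p + 1)))))) w h o) ?_
      (Relation.ReflTransGen.single ?_)
    · refine (step_pipeCfg E web (q' := .expand)
        (ww := some (Sum.inr (Sum.inl (Fin.ofNat _ (p + 1))))) (wm := none)
        (lm := none) (x := none) (by simp)
        (by simp only [pipeStep, hv, hp, pipeAct]) o).trans ?_
      simp [moveHead]
    · refine (step_pipeCfg_expand E web (q' := .cmd (Fin.ofNat _ (p + 1))) hw'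
        (ww := some (Sum.inr (Sum.inl (Fin.ofNat _ (p + 1))))) (wm := none)
        (lm := none) (x := none) rfl o).trans ?_
      simp [moveHead, Tape.write]

/-- The commands that look up identifiers with the given encodings. -/
def lookupCmds (xs : List (List Symb)) : List SeedCmd :=
  xs.flatMap fun x => x.map SeedCmd.put ++ [SeedCmd.expand, SeedCmd.seek]

theorem reaches_lookup {x w r : List Symb} {pre post : List SeedCmd}
    (hc : cmds = pre ++ (lookupCmds [x] ++ post))
    (hr : ∀ h, expandLink E web (linkTape (w ++ x) h : RightTape (PipeSymb cmds.length)) =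
      linkTape (w ++ x ++ r) h)
    {T : Tape (TapeSymb (PipeSymb cmds.length))} (hT : IsBlank T) (o : List Symb) :
    ∃ T', IsBlank T' ∧
      PipeReaches E web cmds M (pipeCfg cmds M (.cmd (Fin.ofNat _ pre.length)) T w w.length o)
        (pipeCfg cmds M (.cmd (Fin.ofNat _ (pre ++ lookupCmds [x]).length)) T'
          (w ++ x ++ r) (w ++ x ++ r).length o) := by
  have hc' : cmds = pre ++ (x.map SeedCmd.put ++ (SeedCmd.expand :: SeedCmd.seek :: post)) := by
    rw [hc]
    simp [lookupCmds]
  have hp1 : cmds[pre.length + x.length]? = some SeedCmd.expand := by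
    conv_lhs => rw [hc']
    simp
  have hp2 : cmds[pre.length + x.length + 1]? = some SeedCmd.seek := by
    conv_lhs => rw [hc', ← List.append_assoc]
    rw [List.getElem?_append_right (by simp)]
    simp [Nat.add_assoc, Nat.add_sub_add_left]
  have h1 := reaches_puts E web (M := M) x hc' T w o
  obtain ⟨T', hT', h2⟩ := reaches_expand E web (M := M) hp1 hT _ _ o (hr _)
  have h3 := reaches_seek E web (M := M) hp2 T' (w ++ x ++ r) o (w ++ x).length (by simp)
  refine ⟨T', hT', (h1.trans h2).trans ?_⟩
  have e : (pre ++ lookupCmds [x]).length = pre.length + x.length + 1 + 1 := by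
    simp [lookupCmds, Nat.add_assoc]
  rw [e]
  exact h3

/-- The first phase looks up the given identifiers one after the other. -/
theorem reaches_lookups [LocallyFiniteOrderBot U] (W : Web U L) (us : List U) {w : List Symb}
    {s : Symb} (hs : ¬ s.IsBit) {pre post : List SeedCmd}
    (hc : cmds = pre ++ (lookupCmds (us.map E.ident) ++ post))
    {T : Tape (TapeSymb (PipeSymb cmds.length))} (hT : IsBlank T) (o : List Symb) :
    let w' := w ++ [s] ++ us.flatMap fun u => E.ident u ++ (E.response W u ++ [Symb.sharp])
    ∃ T', IsBlank T' ∧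
      PipeReaches E (E.web W) cmds M
        (pipeCfg cmds M (.cmd (Fin.ofNat _ pre.length)) T (w ++ [s]) (w ++ [s]).length o)
        (pipeCfg cmds M (.cmd (Fin.ofNat _ (pre ++ lookupCmds (us.map E.ident)).length)) T'
          w' w'.length o) := by
  induction us generalizing w s pre T with
  | nil =>
    refine ⟨T, hT, ?_⟩
    simp only [lookupCmds, List.map_nil, List.flatMap_nil, List.append_nil]
    exact Relation.ReflTransGen.refl
  | cons u us ih =>
    obtain ⟨T₁, hT₁, h₁⟩ := reaches_lookup E (E.web W) (M := M) (x := E.ident u) (w := w ++ [s])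
      (r := E.response W u ++ [Symb.sharp]) (pre := pre)
      (post := lookupCmds (us.map E.ident) ++ post) (by rw [hc]; simp [lookupCmds])
      (fun h => by rw [expandLink_linkTape E W w hs u h]; simp) hT o
    -- The `♯` just appended delimits the next identifier on the left, as the arrow did for the
    -- first one.
    obtain ⟨T₂, hT₂, h₂⟩ := ih (w := w ++ [s] ++ E.ident u ++ E.response W u) (s := Symb.sharp)
      (by rintro ⟨_, ⟨⟩⟩) (pre := pre ++ lookupCmds [E.ident u]) (by rw [hc]; simp [lookupCmds]) hT₁
    refine ⟨T₂, hT₂, h₁.trans ?_⟩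
    simpa only [List.flatMap_cons, List.map_cons, lookupCmds, List.flatMap_nil, List.append_assoc,
      List.append_nil] using h₂

/-! ### The second phase -/

theorem IsBlank.eq_mk {n : ℕ} {T : Tape (TapeSymb (PipeSymb n))} (hT : IsBlank T) :
    T.map (pipeRead n) = ⟨default, ∅, ListBlank.mk []⟩ := hT

/-- Writing a symbol and moving to the left, for a tape that is blank to the left. -/
theorem map_write_move_left {n : ℕ} {T : Tape (TapeSymb (PipeSymb n))} {l : List StackSymb}
    (hT : T.map (pipeRead n) = ⟨default, ∅, ListBlank.mk l⟩) (a : StackSymb) :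
    ((T.write (some (Sum.inr (Sum.inr a)))).move Dir.left).map (pipeRead n) =
      ⟨default, ∅, ListBlank.mk (a :: l)⟩ := by
  rw [Tape.map_move, Tape.map_write, hT]
  rfl

/-- The bits are written least significant first while the work head moves left, so they end up in
reading order. -/
theorem reaches_copy_symb {w : List Symb} {h : ℕ} {s : Symb} (hw : w[h]? = some s)
    (hs : s ≠ Symb.arrow) {T : Tape (TapeSymb (PipeSymb cmds.length))} {l : List StackSymb}
    (hT : T.map (pipeRead cmds.length) = ⟨default, ∅, ListBlank.mk l⟩) (o : List Symb) :
    ∃ T', T'.map (pipeRead cmds.length) =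
        ⟨default, ∅, ListBlank.mk ((digitBits s.digit).map (stackSymb false) ++ l)⟩ ∧
      PipeReaches E web cmds M (pipeCfg cmds M (.copy 0) T w h o)
        (pipeCfg cmds M (.copy 0) T' w (h - 1) o) := by
  have hstep : ∀ (i : Fin 4) (T : Tape (TapeSymb (PipeSymb cmds.length))),
      (pipeMachine cmds M).step E web (pipeCfg cmds M (.copy i) T w h o) =
        some (pipeCfg cmds M (.copy (i + 1))
          ((T.write (some (Sum.inr (Sum.inr
            (stackSymb false (bitSymb (s.digit.testBit i))))))).move Dir.left) w
          (moveHead (if i = 3 then some Dir.left else none) h) o) := by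
    intro i T
    refine (step_pipeCfg E web (q' := .copy (i + 1))
        (ww := some (Sum.inr (Sum.inr (stackSymb false (bitSymb (s.digit.testBit i))))))
        (wm := some Dir.left)
        (lm := if i = 3 then some Dir.left else none) (x := none) (by simp) ?_ o).trans ?_
    · rw [hw]
      cases s <;> first | exact absurd rfl hs | rfl
    · simp
  have h0 := map_write_move_left hT (stackSymb false (bitSymb (s.digit.testBit 0)))
  have h1 := map_write_move_left h0 (stackSymb false (bitSymb (s.digit.testBit 1)))
  have h2 := map_write_move_left h1 (stackSymb false (bitSymb (s.digit.testBit 2)))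
  have h3 := map_write_move_left h2 (stackSymb false (bitSymb (s.digit.testBit 3)))
  exact ⟨_, h3, (((PipeReaches.single (hstep 0 _)).tail (hstep 1 _)).tail
    (hstep 2 _)).tail (hstep 3 _)⟩

/-- Here `v₂` is copied already and `v₁` is still to be copied, from its right end. Because of the
arrow in cell 0, the last symbol of `v₁` is in cell `v₁.length`. -/
theorem reaches_copy (v₁ v₂ : List Symb) (hv : Symb.arrow ∉ v₁)
    {T : Tape (TapeSymb (PipeSymb cmds.length))}
    (hT : T.map (pipeRead cmds.length) =
      ⟨default, ∅, ListBlank.mk ((v₂.flatMap fun s => digitBits s.digit).map (stackSymb false))⟩)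
    (o : List Symb) :
    ∃ T', T'.map (pipeRead cmds.length) =
        ⟨default, ∅, ListBlank.mk ((PartrecToTM2.Γ'.bit1 ::
          (v₁ ++ v₂).flatMap fun s => digitBits s.digit).map (stackSymb false))⟩ ∧
      PipeReaches E web cmds M
        (pipeCfg cmds M (.copy 0) T (Symb.arrow :: (v₁ ++ v₂)) v₁.length o)
        (pipeCfg cmds M .bottom T' (Symb.arrow :: (v₁ ++ v₂)) 0 o) := by
  induction v₁ using List.reverseRecOn generalizing v₂ T with
  | nil =>
    refine ⟨_, map_write_move_left hT (stackSymb false (bitSymb true)),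
      Relation.ReflTransGen.single ?_⟩
    refine (step_pipeCfg E web (q' := .bottom)
        (ww := some (Sum.inr (Sum.inr (stackSymb false (bitSymb true))))) (wm := some Dir.left)
        (lm := none) (x := none) (by simp) rfl o).trans ?_
    simp [moveHead]
  | append_singleton v₁ s ih =>
    have hw : (Symb.arrow :: (v₁ ++ [s] ++ v₂))[(v₁ ++ [s]).length]? = some s := by simp
    obtain ⟨T₁, hT₁, h₁⟩ := reaches_copy_symb E web (M := M) hw
      (by rintro rfl; simp at hv) hT o
    obtain ⟨T₂, hT₂, h₂⟩ := ih (s :: v₂) (fun h => hv (by simp [h])) (T := T₁)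
      (by rw [hT₁]; simp)
    refine ⟨T₂, by rw [hT₂]; simp, h₁.trans ?_⟩
    simpa only [List.length_append, List.length_singleton, Nat.add_sub_cancel, List.append_assoc,
      List.singleton_append] using h₂

/-- The copied bits, with the bottom cell added in front, are literally the initial tape of the
evaluating machine. -/
theorem trInit_digitsNum {l : List ℕ} (hl : ∀ d ∈ l, d < 16) :
    TM2to1.trInit PartrecToTM2.K'.main (PartrecToTM2.trList [digitsNum l]) =
      stackSymb true PartrecToTM2.Γ'.cons ::
        (PartrecToTM2.Γ'.bit1 :: l.flatMap digitBits).map (stackSymb false) := by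
  rw [← trNat_digitsNum hl]
  simp only [TM2to1.trInit, PartrecToTM2.trList, List.reverse_append, List.reverse_cons,
    List.reverse_nil, List.nil_append, List.singleton_append]
  rfl

theorem reaches_run_start {T : Tape (TapeSymb (PipeSymb cmds.length))} {l : List StackSymb}
    (hT : T.map (pipeRead cmds.length) = ⟨default, ∅, ListBlank.mk l⟩) (w : List Symb) (h : ℕ)
    (o : List Symb) :
    ∃ T', T'.map (pipeRead cmds.length) =
        Tape.mk₁ (stackSymb true PartrecToTM2.Γ'.cons :: l) ∧
      PipeReaches E web cmds M (pipeCfg cmds M .bottom T w h o)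
        (pipeCfg cmds M (.run default) T' w h o) := by
  refine ⟨T.write (some (Sum.inr (Sum.inr (stackSymb true PartrecToTM2.Γ'.cons)))), ?_,
    Relation.ReflTransGen.single ?_⟩
  · rw [Tape.map_write, hT]
    rfl
  · refine (step_pipeCfg E web (q' := .run default)
        (ww := some (Sum.inr (Sum.inr (stackSymb true PartrecToTM2.Γ'.cons)))) (wm := none)
        (lm := none) (x := none) (by simp) rfl o).trans ?_
    simp [moveHead]

/-- Since `pipeRead` preserves the blank, it commutes with moves and writes, so each step can be
imitated on any work tape with the right image. -/
theorem reaches_run {c c' : TM0.Cfg StackSymb Q} (hc : TM0.Reaches M c c')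
    {T : Tape (TapeSymb (PipeSymb cmds.length))} (hT : T.map (pipeRead cmds.length) = c.Tape)
    (w : List Symb) (h : ℕ) (o : List Symb) :
    ∃ T', T'.map (pipeRead cmds.length) = c'.Tape ∧
      PipeReaches E web cmds M (pipeCfg cmds M (.run c.q) T w h o)
        (pipeCfg cmds M (.run c'.q) T' w h o) := by
  induction hc with
  | refl => exact ⟨T, hT, Relation.ReflTransGen.refl⟩
  | tail _ hstep ih =>
    rename_i c₁ c₂ _
    obtain ⟨T₁, hT₁, h₁⟩ := ih
    obtain ⟨q₁, S₁⟩ := c₁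
    obtain ⟨q₂, S₂⟩ := c₂
    simp only at hT₁ h₁
    have hhead : pipeRead _ T₁.head = S₁.head := by rw [← hT₁, Tape.map_fst]
    obtain ⟨⟨q', a⟩, hq', he⟩ := Option.map_eq_some_iff.1 hstep
    cases a with
    | move d =>
      simp only [TM0.Cfg.mk.injEq] at he
      obtain ⟨rfl, rfl⟩ := he
      refine ⟨T₁.move d, by rw [Tape.map_move, hT₁], h₁.tail ?_⟩
      refine (step_pipeCfg E web (q' := .run q') (ww := T₁.head) (wm := some d)
        (lm := none) (x := none) (by simp)
        (by simp only [pipeStep, hhead, hq', pipeAct]) o).trans ?_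
      simp [moveHead, Tape.write_self]
    | write a =>
      simp only [TM0.Cfg.mk.injEq] at he
      obtain ⟨rfl, rfl⟩ := he
      refine ⟨T₁.write (some (Sum.inr (Sum.inr a))), by rw [Tape.map_write, hT₁]; rfl, h₁.tail ?_⟩
      refine (step_pipeCfg E web (q' := .run q') (ww := some (Sum.inr (Sum.inr a))) (wm := none)
        (lm := none) (x := none) (by simp)
        (by simp only [pipeStep, hhead, hq', pipeAct]) o).trans ?_
      simp [moveHead]

/-! ### The third phase -/

/-- The stack `main` has the given content from the head on. -/
def MainFrom {n : ℕ} (T : Tape (TapeSymb (PipeSymb n))) (l : List PartrecToTM2.Γ') : Prop :=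
  ∀ i : ℕ, ((T.map (pipeRead n)).nth i).2 PartrecToTM2.K'.main = l[i]?

theorem MainFrom.head {n : ℕ} {T : Tape (TapeSymb (PipeSymb n))} {l : List PartrecToTM2.Γ'}
    (h : MainFrom T l) : (pipeRead n T.head).2 PartrecToTM2.K'.main = l.head? := by
  have := h 0
  rw [← Tape.map_fst, List.head?_eq_getElem?, ← this]
  rfl

theorem MainFrom.tail {n : ℕ} {T : Tape (TapeSymb (PipeSymb n))} {l : List PartrecToTM2.Γ'}
    (h : MainFrom T l) : MainFrom (T.move Dir.right) l.tail := by
  intro i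
  rw [Tape.map_move, Tape.move_right_nth, List.getElem?_tail, ← h (i + 1)]
  rfl

theorem step_run_halt {q : Q} {T : Tape (TapeSymb (PipeSymb cmds.length))}
    (hn : TM0.step M ⟨q, T.map (pipeRead cmds.length)⟩ = none) (w : List Symb) (h : ℕ)
    (o : List Symb) :
    (pipeMachine cmds M).step E web (pipeCfg cmds M (.run q) T w h o) =
      some (pipeCfg cmds M (.out 0) (T.move Dir.right) w h o) := by
  have hM : M q (pipeRead _ T.head) = none := by
    rw [← Tape.map_fst]
    exact Option.map_eq_none_iff.1 hn
  refine (step_pipeCfg E web (q' := .out 0) (ww := T.head) (wm := some Dir.right)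
    (lm := none) (x := none) (by simp) (by simp only [pipeStep, hM, pipeAct]) o).trans ?_
  simp [moveHead, Tape.write_self]

theorem step_out_small {acc : Fin 16} {T : Tape (TapeSymb (PipeSymb cmds.length))} {b : Bool}
    {l : List PartrecToTM2.Γ'} (hT : MainFrom T (bitSymb b :: l)) (w : List Symb) (h : ℕ)
    (o : List Symb) (hm : 2 * acc.val + b.toNat < 16) :
    (pipeMachine cmds M).step E web (pipeCfg cmds M (.out acc) T w h o) =
      some (pipeCfg cmds M (.out (Fin.ofNat _ (2 * acc.val + b.toNat))) (T.move Dir.right)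
        w h o) := by
  have hb : (if bitSymb b = PartrecToTM2.Γ'.bit1 then 1 else 0) = b.toNat := by cases b <;> rfl
  refine (step_pipeCfg E web (q' := .out (Fin.ofNat _ (2 * acc.val + b.toNat))) (ww := T.head)
    (wm := some Dir.right) (lm := none) (x := none) (by simp)
    (by simp only [pipeStep, hT.head, List.head?_cons, hb, if_neg (not_le.2 hm), pipeAct])
    o).trans ?_
  simp [moveHead, Tape.write_self]

theorem step_out_large {acc : Fin 16} {T : Tape (TapeSymb (PipeSymb cmds.length))} {b : Bool}
    {l : List PartrecToTM2.Γ'} (hT : MainFrom T (bitSymb b :: l)) (w : List Symb) (h : ℕ)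
    (o : List Symb) (hm : 16 ≤ 2 * acc.val + b.toNat) :
    (pipeMachine cmds M).step E web (pipeCfg cmds M (.out acc) T w h o) =
      some (pipeCfg cmds M (.out 1) (T.move Dir.right) w h
        (o ++ [Symb.ofDigit (2 * acc.val + b.toNat - 16)])) := by
  have hb : (if bitSymb b = PartrecToTM2.Γ'.bit1 then 1 else 0) = b.toNat := by cases b <;> rfl
  refine (step_pipeCfg E web (q' := .out 1) (ww := T.head)
    (wm := some Dir.right) (lm := none)
    (x := some (Symb.ofDigit (2 * acc.val + b.toNat - 16))) (by simp)
    (by simp only [pipeStep, hT.head, List.head?_cons, hb, if_pos hm, pipeAct]) o).trans ?_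
  simp [moveHead, Tape.write_self]

theorem reaches_out_symb (s : Symb) {T : Tape (TapeSymb (PipeSymb cmds.length))}
    {l : List PartrecToTM2.Γ'} (hT : MainFrom T (digitBits s.digit ++ l)) (w : List Symb) (h : ℕ)
    (o : List Symb) :
    ∃ T', MainFrom T' l ∧
      PipeReaches E web cmds M (pipeCfg cmds M (.out 1) T w h o)
        (pipeCfg cmds M (.out 1) T' w h (o ++ [s])) := by
  have h0 : MainFrom T (bitSymb (s.digit.testBit 3) :: bitSymb (s.digit.testBit 2) ::
    bitSymb (s.digit.testBit 1) :: bitSymb (s.digit.testBit 0) :: l) := hT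
  have h1 := h0.tail
  have h2 := h1.tail
  have h3 := h2.tail
  refine ⟨_, h3.tail, ?_⟩
  have hlt : ∀ b : Bool, b.toNat < 2 := Bool.toNat_lt
  have e1 := hlt (s.digit.testBit 3)
  have e2 := hlt (s.digit.testBit 2)
  have e3 := hlt (s.digit.testBit 1)
  have v1 : (Fin.ofNat 16 (2 * (1 : Fin 16).val + (s.digit.testBit 3).toNat)).val =
      2 + (s.digit.testBit 3).toNat := Nat.mod_eq_of_lt (by simp; omega)
  have v2 : (Fin.ofNat 16 (2 * (2 + (s.digit.testBit 3).toNat) +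
      (s.digit.testBit 2).toNat)).val = 2 * (2 + (s.digit.testBit 3).toNat) +
      (s.digit.testBit 2).toNat := Nat.mod_eq_of_lt (by omega)
  have v3 : (Fin.ofNat 16 (2 * (2 * (2 + (s.digit.testBit 3).toNat) +
      (s.digit.testBit 2).toNat) + (s.digit.testBit 1).toNat)).val =
      2 * (2 * (2 + (s.digit.testBit 3).toNat) +
      (s.digit.testBit 2).toNat) + (s.digit.testBit 1).toNat := Nat.mod_eq_of_lt (by omega)
  -- After one, two and three bits the accumulator is at most 3, 7 and 15; the fourth bit gives 16
  -- plus the digit.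
  have r0 := step_out_small E web (M := M) (acc := 1) h0 w h o (by simp; omega)
  have r1 := step_out_small E web (M := M) h1 w h o
    (acc := Fin.ofNat 16 (2 * (1 : Fin 16).val + (s.digit.testBit 3).toNat))
    (by rw [v1]; omega)
  rw [v1] at r1
  have r2 := step_out_small E web (M := M) h2 w h o
    (acc := Fin.ofNat 16 (2 * (2 + (s.digit.testBit 3).toNat) + (s.digit.testBit 2).toNat))
    (by rw [v2]; omega)
  rw [v2] at r2
  have r3 := step_out_large E web (M := M) h3 w h o
    (acc := Fin.ofNat 16 (2 * (2 * (2 + (s.digit.testBit 3).toNat) +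
      (s.digit.testBit 2).toNat) + (s.digit.testBit 1).toNat)) (by rw [v3]; omega)
  rw [v3] at r3
  have hd : Symb.ofDigit (2 * (2 * (2 * (2 + (s.digit.testBit 3).toNat) +
      (s.digit.testBit 2).toNat) + (s.digit.testBit 1).toNat) + (s.digit.testBit 0).toNat - 16) =
      s := by
    rcases s with (_ | _) | _ | _ | _ | _ | _ | _ | _ <;> rfl
  rw [hd] at r3
  exact (((PipeReaches.single r0).tail r1).tail r2).tail r3

theorem reaches_out (out : List Symb) {T : Tape (TapeSymb (PipeSymb cmds.length))}
    (hT : MainFrom T (out.flatMap fun s => digitBits s.digit)) (w : List Symb) (h : ℕ)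
    (o : List Symb) :
    ∃ c, PipeReaches E web cmds M (pipeCfg cmds M (.out 1) T w h o) c ∧
      (pipeMachine cmds M).step E web c = none ∧ c.out = o ++ out := by
  induction out generalizing T o with
  | nil =>
    refine ⟨_, Relation.ReflTransGen.refl, ?_, (List.append_nil _).symm⟩
    have hs : pipeStep cmds M (.out 1) T.head ((w[h]?).map Sum.inl) = none := by
      simp only [pipeStep, hT.head, List.flatMap_nil, List.head?_nil]
    have hq : (.out 1 : PipeState cmds.length Q) ≠ .expand := by simp
    exact (if_neg hq).trans (congrArg (Option.map _) hs)
  | cons s out ih =>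
    obtain ⟨T₁, hT₁, h₁⟩ := reaches_out_symb E web (M := M) s (by simpa using hT) w h o
    obtain ⟨c, hc, hn, ho⟩ := ih hT₁ (o ++ [s])
    exact ⟨c, h₁.trans hc, hn, by simp [ho]⟩

end Run

/-- A query is finitely computable if its result is a computable function of the documents of
finitely many identifiers. -/
theorem finitelyComputable_of_lookup {U L V : Type*} [LinearOrder U] [LocallyFiniteOrderBot U]
    [LinearOrder L] [LinearOrder V] (E : Encoding U L V) (us : List U) {f : ℕ → ℕ}
    (hf : Computable f) (q : LDQuery U L V)
    (hq : ∀ W : Web U L, ∃ out : List Symb, E.IsResult (q W) out ∧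
      f (digitsNum ((us.flatMap fun u =>
        E.ident u ++ (E.response W u ++ [Symb.sharp])).map Symb.digit)) =
          digitsNum (out.map Symb.digit)) :
    FinitelyComputable E q := by
  obtain ⟨Q, hQ, hi, M, hM⟩ := exists_TM0_of_computable hf
  refine ⟨pipeMachine (SeedCmd.put Symb.arrow :: lookupCmds (us.map E.ident)) M, fun W => ?_⟩
  obtain ⟨out, hout, hfout⟩ := hq W
  set cmds := SeedCmd.put Symb.arrow :: lookupCmds (us.map E.ident) with hcmds
  set v := us.flatMap fun u => E.ident u ++ (E.response W u ++ [Symb.sharp]) with hv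
  have hb : IsBlank (Tape.mk₁ [] : Tape (TapeSymb (PipeSymb cmds.length))) := by
    unfold IsBlank
    rw [Tape.map_mk₁]
    rfl
  have r1 := reaches_put E (E.web W) (cmds := cmds) (M := M) (p := 0) (s := Symb.arrow) rfl
    (Tape.mk₁ []) [] []
  obtain ⟨T₂, hT₂, r2⟩ := reaches_lookups E (M := M) W us (w := []) (s := Symb.arrow)
    (by rintro ⟨_, ⟨⟩⟩) (pre := [SeedCmd.put Symb.arrow]) (post := []) (cmds := cmds)
    (by rw [hcmds]; simp) hb []
  have r3 : (pipeMachine cmds M).step E (E.web W) (pipeCfg cmds M (.cmd (Fin.ofNat _ cmds.length))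
      T₂ (Symb.arrow :: v) (Symb.arrow :: v).length []) =
      some (pipeCfg cmds M (.copy 0) T₂ (Symb.arrow :: v) v.length []) := by
    have hval : (Fin.ofNat (cmds.length + 1) cmds.length).val = cmds.length :=
      Nat.mod_eq_of_lt (by omega)
    have hn : cmds[cmds.length]? = none := by simp
    refine (step_pipeCfg E _ (q' := .copy 0) (ww := T₂.head) (wm := none)
      (lm := some Dir.left) (x := none) (by simp)
      (by simp only [pipeStep, hval, hn, pipeAct]) []).trans ?_
    simp [moveHead, Tape.write_self]
  have harrow : Symb.arrow ∉ v := by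
    have h : ∀ u, Symb.arrow ∉ E.ident u := fun u hx => by
      obtain ⟨b, hb⟩ := E.isBit_of_mem_term hx
      cases hb
    simp [hv, h, E.arrow_notMem_response]
  obtain ⟨T₄, hT₄, r4⟩ := reaches_copy E (E.web W) (M := M) v [] harrow hT₂.eq_mk []
  obtain ⟨T₅, hT₅, r5⟩ := reaches_run_start E (E.web W) (M := M) hT₄ (Symb.arrow :: (v ++ [])) 0 []
  obtain ⟨q, R, hreach, hhalt, hR⟩ := hM (digitsNum (v.map Symb.digit))
  have hdig : ∀ l : List Symb, ∀ d ∈ l.map Symb.digit, d < 16 := by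
    intro l d hd
    obtain ⟨s, -, rfl⟩ := List.mem_map.1 hd
    exact s.digit_lt
  rw [trInit_digitsNum (hdig v)] at hreach
  obtain ⟨T₆, hT₆, r6⟩ := reaches_run E (E.web W) (M := M) hreach (T := T₅)
    (by rw [hT₅, List.append_nil, List.flatMap_map]; rfl) (Symb.arrow :: (v ++ [])) 0 []
  have r7 := step_run_halt E (E.web W) (M := M) (q := q) (T := T₆) (by rw [hT₆]; exact hhalt)
    (Symb.arrow :: (v ++ [])) 0 []
  have hmain : MainFrom T₆ (PartrecToTM2.Γ'.cons :: PartrecToTM2.Γ'.bit1 ::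
      out.flatMap fun s => digitBits s.digit) := by
    intro i
    rw [hT₆, Tape.mk'_nth_nat, hR, hfout]
    simp only [PartrecToTM2.trList, List.reverse_append, List.reverse_cons, List.reverse_nil,
      trNat_digitsNum (hdig out), List.flatMap_map]
    rfl
  -- The terminator has been skipped; this step consumes the leading 1 of the number, and the digits
  -- of `out` follow.
  have r8 := step_out_small E (E.web W) (M := M) (acc := 0) (b := true) hmain.tail
    (Symb.arrow :: (v ++ [])) 0 [] (by decide)
  obtain ⟨c, r9, hc, hco⟩ := reaches_out E (E.web W) (M := M) out hmain.tail.tail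
    (Symb.arrow :: (v ++ [])) 0 []
  refine ⟨c, ?_, hc, by rw [hco]; exact hout⟩
  have hstart : (pipeMachine cmds M).init [] = pipeCfg cmds M (.cmd (Fin.ofNat _ 0))
      (Tape.mk₁ []) [] 0 [] := by
    simp only [LDMachine.init, pipeCfg, linkTape_nil]
    rfl
  rw [hstart]
  simp only [List.append_nil] at r4 r5 r6 r7 r8 r9
  have r12 : PipeReaches E (E.web W) cmds M _ _ := Relation.ReflTransGen.trans r1 r2
  exact ((((Relation.ReflTransGen.tail r12 r3).trans r4).trans (r5.trans r6)).tail r7).tail r8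
    |>.trans r9

/-! ## Conjunctive queries over lists of digits -/

/-- The state of reading triples: the triples so far, the components of the current triple so far,
and the current component so far. -/
abbrev ReadState : Type := List (List (List ℕ)) × List (List ℕ) × List ℕ

/-- Reading one digit. -/
def readDigit (st : ReadState) (d : ℕ) : ReadState :=
  if d < 2 then (st.1, st.2.1, st.2.2 ++ [d])
  else if d = 7 then (st.1, st.2.1 ++ [st.2.2], [])
  else if d = 4 then (st.1 ++ [st.2.1 ++ [st.2.2]], [], [])
  else (st.1, [], [])

/-- The triples that occur in a word, with their components as lists of digits. -/
def readTriples (l : List ℕ) : List (List (List ℕ)) :=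
  (l.foldl readDigit ([], [], [])).1

/-- The elements of a list without repetition. -/
def distinct (l : List (List ℕ)) : List (List ℕ) := l.foldr List.insert []

/-- All lists of length `n` with elements from `X`. -/
def tuples (X : List (List ℕ)) : ℕ → List (List (List ℕ))
  | 0 => [[]]
  | n + 1 => X.flatMap fun x => (tuples X n).map (x :: ·)

/-- The value of a variable or constant. -/
def termVal (a : List (List ℕ)) : ℕ ⊕ List ℕ → List ℕ
  | Sum.inl i => a.getD i []
  | Sum.inr x => x

/-- The value of a triple of variables and constants. -/
def tripleVal (a : List (List ℕ)) (t : (ℕ ⊕ List ℕ) × (ℕ ⊕ List ℕ) × (ℕ ⊕ List ℕ)) :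
    List (List ℕ) :=
  [termVal a t.1, termVal a t.2.1, termVal a t.2.2]

/-- The assignments of values to `n` variables for which all patterns take values in `T`. -/
def answers (n : ℕ) (ps : List ((ℕ ⊕ List ℕ) × (ℕ ⊕ List ℕ) × (ℕ ⊕ List ℕ)))
    (T : List (List (List ℕ))) : List (List (List ℕ)) :=
  (tuples (distinct T.flatten) n).filter fun a => ∀ p ∈ ps, tripleVal a p ∈ T

/-- The encoding of an assignment to variables with the given names. -/
def writeAnswer (names : List (List ℕ)) (a : List (List ℕ)) : List ℕ :=
  5 :: (((List.range names.length).flatMap fun i =>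
    7 :: (names.getD i [] ++ 8 :: a.getD i [])).tail ++ [6])

/-- The encodings of all answers. -/
def writeAnswers (names : List (List ℕ))
    (ps : List ((ℕ ⊕ List ℕ) × (ℕ ⊕ List ℕ) × (ℕ ⊕ List ℕ))) (l : List ℕ) : List ℕ :=
  (answers names.length ps (readTriples l)).flatMap (writeAnswer names)

/-- Splitting off the last hexadecimal digit. -/
def splitDigit (s : ℕ × List ℕ) : ℕ × List ℕ :=
  if s.1 < 2 then s else (s.1 / 16, s.1 % 16 :: s.2)

/-- The list of digits that a number represents. -/
def numDigits (n : ℕ) : List ℕ := (splitDigit^[n] (n, [])).2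

/-- As many splittings as there are digits recover the list and leave the leading 1, which further
splittings do not change. The number bounds the length of the list, so iterating that many times is
enough and needs no search. -/
theorem numDigits_digitsNum {l : List ℕ} (hl : ∀ d ∈ l, d < 16) : numDigits (digitsNum l) = l := by
  have h1 : ∀ l : List ℕ, (∀ d ∈ l, d < 16) → ∀ r,
      splitDigit^[l.length] (digitsNum l, r) = (1, l ++ r) := by
    intro l
    induction l using List.reverseRecOn with
    | nil => intro _ r; rfl
    | append_singleton l d ih =>
      intro hl r
      have hd : d < 16 := hl d (by simp)
      have hpos := digitsNum_pos l
      have e : digitsNum (l ++ [d]) = 16 * digitsNum l + d := by simp [digitsNum]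
      have es : splitDigit (digitsNum (l ++ [d]), r) = (digitsNum l, d :: r) := by
        rw [splitDigit, e, if_neg (by simp; omega)]
        simp only [Prod.mk.injEq, List.cons.injEq, and_true]
        omega
      rw [List.length_append, List.length_singleton, Function.iterate_succ_apply, es,
        ih fun d hd => hl d (by simp [hd])]
      simp
  have h2 : ∀ (k : ℕ) (r : List ℕ), splitDigit^[k] (1, r) = (1, r) := by
    intro k r
    induction k with
    | zero => rfl
    | succ k ih => rw [Function.iterate_succ_apply, show splitDigit (1, r) = (1, r) from rfl, ih]
  have h3 : ∀ l : List ℕ, l.length ≤ digitsNum l := by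
    intro l
    induction l using List.reverseRecOn with
    | nil => simp
    | append_singleton l d ih =>
      have hpos := digitsNum_pos l
      have e : digitsNum (l ++ [d]) = 16 * digitsNum l + d := by simp [digitsNum]
      rw [e, List.length_append, List.length_singleton]
      omega
  obtain ⟨k, hk⟩ := Nat.exists_eq_add_of_le (h3 l)
  rw [numDigits]
  conv_lhs => rw [show splitDigit^[digitsNum l] = splitDigit^[k + l.length] from by
    rw [hk, Nat.add_comm]]
  rw [Function.iterate_add_apply, h1 l hl, h2]
  simp

/-! ### Primitive recursiveness of the evaluation -/

section Primrec

open Primrec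

theorem primrec_digitsNum : Primrec digitsNum :=
  list_foldl .id (.const 1)
    (nat_add.comp (nat_mul.comp (.const 16) (fst.comp snd)) (snd.comp snd)).to₂

theorem primrec_splitDigit : Primrec splitDigit :=
  ite (nat_lt.comp fst (.const 2)) .id
    (pair (nat_div.comp fst (.const 16)) (list_cons.comp (nat_mod.comp fst (.const 16)) snd))

theorem primrec_numDigits : Primrec numDigits :=
  snd.comp (nat_iterate .id (pair .id (.const [])) (primrec_splitDigit.comp snd).to₂)

theorem primrec_readDigit : Primrec₂ readDigit := by
  have d : Primrec fun p : ReadState × ℕ => p.2 := snd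
  have T : Primrec fun p : ReadState × ℕ => p.1.1 := fst.comp fst
  have fs : Primrec fun p : ReadState × ℕ => p.1.2.1 := fst.comp (snd.comp fst)
  have cur : Primrec fun p : ReadState × ℕ => p.1.2.2 := snd.comp (snd.comp fst)
  have fs' := list_concat.comp fs cur
  exact ite (nat_lt.comp d (.const 2)) (pair T (pair fs (list_concat.comp cur d)))
    (ite (Primrec.eq.comp d (.const 7)) (pair T (pair fs' (.const [])))
      (ite (Primrec.eq.comp d (.const 4))
        (pair (list_concat.comp T fs') (pair (.const []) (.const [])))
        (pair T (pair (.const []) (.const [])))))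

theorem primrec_readTriples : Primrec readTriples :=
  fst.comp (list_foldl .id (.const ([], [], [])) (primrec_readDigit.comp (fst.comp snd)
    (snd.comp snd)).to₂)

theorem primrecRel_mem {α : Type*} [Primcodable α] : PrimrecRel fun (a : α) (l : List α) => a ∈ l :=
  ((PrimrecRel.exists_mem_list (Primrec.eq (α := α))).comp snd fst).of_eq fun p => by
    simp

theorem primrec_insert : Primrec₂ fun (a : List ℕ) (l : List (List ℕ)) => l.insert a :=
  (ite (primrecRel_mem (α := List ℕ)) snd list_cons).of_eq fun p => by
    by_cases h : p.1 ∈ p.2 <;> simp [h]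

theorem primrec_distinct : Primrec distinct :=
  list_foldr .id (.const []) (primrec_insert.comp (fst.comp snd) (snd.comp snd)).to₂

/-- The query is fixed, so the number of variables is a constant: the induction on `n` takes place
outside the primitive recursive function. The patterns are treated in the same way in
`primrecRel_isAnswer`. -/
theorem primrec_tuples (n : ℕ) : Primrec fun X => tuples X n := by
  induction n with
  | zero => exact .const _
  | succ n ih =>
    exact list_flatMap .id (list_map (ih.comp fst) (list_cons.comp (snd.comp fst) snd).to₂).to₂

theorem primrec_termVal (t : ℕ ⊕ List ℕ) : Primrec fun a => termVal a t := by
  cases t with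
  | inl i => exact (list_getD []).comp .id (.const i)
  | inr x => exact .const x

theorem primrec_tripleVal (t : (ℕ ⊕ List ℕ) × (ℕ ⊕ List ℕ) × (ℕ ⊕ List ℕ)) :
    Primrec fun a => tripleVal a t :=
  list_cons.comp (primrec_termVal _) (list_cons.comp (primrec_termVal _)
    (list_cons.comp (primrec_termVal _) (.const [])))

theorem primrecRel_isAnswer (ps : List ((ℕ ⊕ List ℕ) × (ℕ ⊕ List ℕ) × (ℕ ⊕ List ℕ))) :
    PrimrecRel fun (a : List (List ℕ)) (T : List (List (List ℕ))) =>
      ∀ p ∈ ps, tripleVal a p ∈ T := by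
  induction ps with
  | nil => exact (Primrec.eq.comp (.const 0) (.const 0)).of_eq fun p => by simp
  | cons p ps ih =>
    exact (PrimrecPred.and (primrecRel_mem.comp ((primrec_tripleVal p).comp fst) snd) ih).of_eq
      fun a => by simp

theorem primrec_answers (n : ℕ) (ps : List ((ℕ ⊕ List ℕ) × (ℕ ⊕ List ℕ) × (ℕ ⊕ List ℕ))) :
    Primrec (answers n ps) :=
  (PrimrecRel.listFilter (primrecRel_isAnswer ps)).comp
    ((primrec_tuples n).comp (primrec_distinct.comp list_flatten)) .id

theorem primrec_writeAnswer (names : List (List ℕ)) : Primrec (writeAnswer names) := by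
  have h : Primrec fun a : List (List ℕ) => (List.range names.length).flatMap fun i =>
      7 :: (names.getD i [] ++ 8 :: a.getD i []) := by
    refine list_flatMap (.const _) (list_cons.comp (.const 7) (list_append.comp
      ((list_getD []).comp (.const names) snd) (list_cons.comp (.const 8)
        ((list_getD []).comp fst snd)))).to₂
  exact list_cons.comp (.const 5) (list_concat.comp (list_tail.comp h) (.const 6))

theorem primrec_writeAnswers (names : List (List ℕ))
    (ps : List ((ℕ ⊕ List ℕ) × (ℕ ⊕ List ℕ) × (ℕ ⊕ List ℕ))) :
    Primrec (writeAnswers names ps) :=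
  list_flatMap ((primrec_answers _ _).comp primrec_readTriples)
    ((primrec_writeAnswer names).comp snd).to₂

end Primrec

/-! ### Correctness of the search for answers -/

theorem mem_distinct {l : List (List ℕ)} {x : List ℕ} : x ∈ distinct l ↔ x ∈ l := by
  induction l with
  | nil => rfl
  | cons y l ih =>
    rw [distinct, List.foldr_cons, List.mem_insert_iff, List.mem_cons]
    exact or_congr_right ih

theorem nodup_distinct (l : List (List ℕ)) : (distinct l).Nodup := by
  induction l with
  | nil => exact List.nodup_nil
  | cons y l ih => exact List.Nodup.insert ih

theorem mem_tuples {X : List (List ℕ)} {n : ℕ} {a : List (List ℕ)} :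
    a ∈ tuples X n ↔ a.length = n ∧ ∀ x ∈ a, x ∈ X := by
  induction n generalizing a with
  | zero =>
    simp only [tuples, List.mem_singleton, List.length_eq_zero_iff]
    constructor
    · rintro rfl
      simp
    · exact fun h => h.1
  | succ n ih =>
    cases a with
    | nil => simp [tuples]
    | cons x a =>
      simp [tuples, ih]
      tauto

theorem nodup_tuples {X : List (List ℕ)} (hX : X.Nodup) (n : ℕ) : (tuples X n).Nodup := by
  induction n with
  | zero => simp [tuples]
  | succ n ih =>
    rw [tuples, List.nodup_flatMap]
    refine ⟨fun x _ => ih.map fun a b h => by simpa using h, hX.imp fun hxy => ?_⟩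
    intro a ha hb
    obtain ⟨c, -, rfl⟩ := List.mem_map.1 ha
    obtain ⟨d, -, hd⟩ := List.mem_map.1 hb
    exact hxy (List.cons.inj hd).1.symm

theorem nodup_answers (n : ℕ) (ps : List ((ℕ ⊕ List ℕ) × (ℕ ⊕ List ℕ) × (ℕ ⊕ List ℕ)))
    (T : List (List (List ℕ))) : (answers n ps T).Nodup :=
  (nodup_tuples (nodup_distinct _) n).filter _

theorem mem_answers {n : ℕ} {ps : List ((ℕ ⊕ List ℕ) × (ℕ ⊕ List ℕ) × (ℕ ⊕ List ℕ))}
    {T : List (List (List ℕ))} {a : List (List ℕ)} :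
    a ∈ answers n ps T ↔ a.length = n ∧ (∀ x ∈ a, ∃ t ∈ T, x ∈ t) ∧
      ∀ p ∈ ps, tripleVal a p ∈ T := by
  simp [answers, mem_tuples, mem_distinct, and_assoc]

/-! ## Conjunctive Linked Data queries without link traversal -/

namespace Encoding

variable {U L V : Type*} (E : Encoding U L V)

/-- The encoding of an identifier or literal, as a list of digits. -/
def termDigits (x : U ⊕ L) : List ℕ := (E.term x).map Symb.digit

theorem termDigits_injective : Function.Injective E.termDigits :=
  (List.map_injective_iff.2 (Function.LeftInverse.injective Symb.ofDigit_digit)).comp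
    E.term_injective

/-- The components of a data triple, as lists of digits. -/
def tripleDigits (t : DataTriple U L) : List (List ℕ) :=
  [E.termDigits (Sum.inl t.subj), E.termDigits (Sum.inl t.pred), E.termDigits t.obj]

theorem foldl_readDigit_term (x : U ⊕ L) (T : List (List (List ℕ))) (fs : List (List ℕ))
    (cur : List ℕ) :
    (E.termDigits x).foldl readDigit (T, fs, cur) = (T, fs, cur ++ E.termDigits x) := by
  have h : ∀ l : List ℕ, (∀ d ∈ l, d < 2) → ∀ cur,
      l.foldl readDigit (T, fs, cur) = (T, fs, cur ++ l) := by
    intro l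
    induction l with
    | nil => simp
    | cons d l ih =>
      intro hl cur
      rw [List.foldl_cons, readDigit, if_pos (hl d (by simp)), ih fun e he => hl e (by simp [he])]
      simp
  refine h _ (fun d hd => ?_) cur
  obtain ⟨s, hs, rfl⟩ := List.mem_map.1 hd
  obtain ⟨b, rfl⟩ := E.isBit_of_mem_term hs
  exact Bool.toNat_lt b

/-- The opening bracket clears whatever has been read in part, so only the completed triples of `st`
matter. -/
theorem foldl_readDigit_triple (t : DataTriple U L) (st : ReadState) :
    ((E.triple t).map Symb.digit).foldl readDigit st =
      (st.1 ++ [E.tripleDigits t], [], []) := by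
  have h : (E.triple t).map Symb.digit = 3 :: (E.termDigits (Sum.inl t.subj) ++ 7 ::
      (E.termDigits (Sum.inl t.pred) ++ 7 :: (E.termDigits t.obj ++ [4]))) := by
    simp [triple_eq, termDigits, ident, Symb.digit]
  rw [h, List.foldl_cons, show readDigit st 3 = (st.1, [], []) from rfl, List.foldl_append,
    foldl_readDigit_term, List.foldl_cons, List.nil_append,
    show ∀ T fs cur, readDigit (T, fs, cur) 7 = (T, fs ++ [cur], []) from fun _ _ _ => rfl,
    List.foldl_append, foldl_readDigit_term, List.foldl_cons,
    show ∀ T fs cur, readDigit (T, fs, cur) 7 = (T, fs ++ [cur], []) from fun _ _ _ => rfl,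
    List.foldl_append, foldl_readDigit_term, List.foldl_cons, List.foldl_nil]
  rfl

variable [LinearOrder U] [LinearOrder L]

theorem foldl_readDigit_triples (s : Finset (DataTriple U L)) (st : ReadState) :
    ((E.triples s).map Symb.digit).foldl readDigit st =
      (st.1 ++ (s.sort (· ≤ ·)).map E.tripleDigits, [], []) := by
  have h : ∀ (l : List (DataTriple U L)) (st : ReadState), ∃ r : List (List ℕ) × List ℕ,
      (([Symb.comma].intercalate (l.map E.triple)).map Symb.digit).foldl readDigit st =
        (st.1 ++ l.map E.tripleDigits, r) := by
    intro l
    induction l with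
    | nil => exact fun st => ⟨st.2, by simp⟩
    | cons t l ih =>
      intro st
      cases l with
      | nil => exact ⟨_, by simpa using E.foldl_readDigit_triple t st⟩
      | cons t' l =>
        -- The comma between two triples is read as the end of an empty component, which the next
        -- opening bracket discards.
        obtain ⟨r, hr⟩ := ih (st.1 ++ [E.tripleDigits t], [[]], [])
        refine ⟨r, ?_⟩
        rw [List.map_cons, List.map_cons, intercalate_cons_cons, ← List.map_cons (f := E.triple),
          List.map_append, List.map_append, List.foldl_append, List.foldl_append,
          foldl_readDigit_triple]
        refine hr.trans ?_
        simp
  obtain ⟨r, hr⟩ := h (s.sort (· ≤ ·)) (st.1, [], [])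
  rw [triples, List.map_append, List.map_append, List.foldl_append, List.foldl_append]
  have e : ([Symb.ldangle].map Symb.digit).foldl readDigit st = (st.1, [], []) := rfl
  rw [e, hr]
  rfl

/-- The triples of a document that is looked up. -/
noncomputable def responseTriples (W : Web U L) (u : U) : List (List (List ℕ)) :=
  (W.adoc u).elim [] fun d => ((W.data d).sort (· ≤ ·)).map E.tripleDigits

/-- The identifiers and the `♯` between documents leave no trace, since every bracket or `♯`
discards digits outside a triple. -/
theorem readTriples_lookups (W : Web U L) (us : List U) :
    readTriples ((us.flatMap fun u =>
      E.ident u ++ (E.response W u ++ [Symb.sharp])).map Symb.digit) =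
      us.flatMap (E.responseTriples W) := by
  have h : ∀ (us : List U) (st : ReadState), (((us.flatMap fun u =>
      E.ident u ++ (E.response W u ++ [Symb.sharp])).map Symb.digit).foldl readDigit st).1 =
      st.1 ++ us.flatMap (E.responseTriples W) := by
    intro us
    induction us with
    | nil => simp
    | cons u us ih =>
      intro st
      obtain ⟨T, fs, cur⟩ := st
      rw [List.flatMap_cons, List.map_append, List.foldl_append, ih, List.flatMap_cons]
      refine Eq.trans ?_ (List.append_assoc _ _ _)
      congr 1
      rw [List.map_append, List.foldl_append,
        show (E.ident u).map Symb.digit = E.termDigits (Sum.inl u) from rfl,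
        foldl_readDigit_term, List.map_append, List.foldl_append]
      unfold response responseTriples
      cases W.adoc u with
      | none => simp [readDigit, Symb.digit]
      | some d =>
        rw [Option.elim_some, Option.elim_some, doc, foldl_readDigit_triples]
        rfl
  exact (h us ([], [], [])).trans (List.nil_append _)

theorem mem_responseTriples {W : Web U L} {u : U} {x : List (List ℕ)} :
    x ∈ E.responseTriples W u ↔
      ∃ d, W.adoc u = some d ∧ ∃ t ∈ W.data d, E.tripleDigits t = x := by
  unfold responseTriples
  cases W.adoc u <;> simp

end Encoding

/-! ### Solutions of the query as answers over digit lists -/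

section Query

variable {U L V : Type*}

theorem finite_setOf_inl_eq {α β : Type*} (y : α ⊕ β) : {v : α | Sum.inl v = y}.Finite :=
  Set.Subsingleton.finite fun a ha b hb =>
    Sum.inl_injective ((show Sum.inl a = y from ha).trans (show Sum.inl b = y from hb).symm)

theorem TriplePattern.finite_vars (tp : TriplePattern U L V) : tp.vars.Finite :=
  (finite_setOf_inl_eq tp.subj).union
    ((finite_setOf_inl_eq tp.pred).union (finite_setOf_inl_eq tp.obj))

theorem BQP.finite_vars (P : BQP U L V) : (BQP.vars P).Finite := by
  have : BQP.vars P = ⋃ tp ∈ P, tp.vars := by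
    ext v
    simp [BQP.vars]
  rw [this]
  exact P.finite_toSet.biUnion fun tp _ => tp.finite_vars

/-- The terms of a triple pattern. -/
def TriplePattern.terms (tp : TriplePattern U L V) :
    (V ⊕ (U ⊕ L)) × (V ⊕ (U ⊕ L)) × (V ⊕ (U ⊕ L)) :=
  (tp.subj.map id Sum.inl, tp.pred.map id Sum.inl, tp.obj)

theorem TriplePattern.mem_vars {tp : TriplePattern U L V} {v : V} :
    v ∈ tp.vars ↔ Sum.inl v = tp.terms.1 ∨ Sum.inl v = tp.terms.2.1 ∨
      Sum.inl v = tp.terms.2.2 := by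
  have h : ∀ y : V ⊕ U, (Sum.inl v : V ⊕ U) = y ↔
      (Sum.inl v : V ⊕ (U ⊕ L)) = y.map id Sum.inl := by
    rintro (y | y) <;> simp
  exact or_congr (h _) (or_congr (h _) Iff.rfl)

/-- Without link traversal, exactly the documents of the seed identifiers are reachable. -/
theorem reachable_cNone_iff {S : Finset U} {P : BQP U L V} {W : Web U L} {d : W.D} :
    Reachable S cNone P W d ↔ ∃ u ∈ S, W.adoc u = some d := by
  constructor
  · rintro (⟨u, _, hu, hd⟩ | ⟨_, _, _, _, _, _, _, h, _⟩)
    · exact ⟨u, hu, hd⟩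
    · cases h
  · rintro ⟨u, hu, hd⟩
    exact Reachable.seed u d hu hd

theorem mem_reachablePart_allData {S : Finset U} {c : ReachabilityCriterion U L V} {P : BQP U L V}
    {W : Web U L} {t : DataTriple U L} :
    t ∈ (reachablePart S c P W).allData ↔ ∃ d, Reachable S c P W d ∧ t ∈ W.data d :=
  ⟨fun ⟨d, hd⟩ => ⟨d.1, d.2, hd⟩, fun ⟨d, hd, ht⟩ => ⟨⟨d, hd⟩, ht⟩⟩

theorem valuation_eq_some {P : BQP U L V} {μ : Valuation U L V} (hμ : μ.dom = BQP.vars P) {v : V}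
    (hv : v ∈ BQP.vars P) : ∃ y, μ.toFun v = some y := by
  rw [← hμ] at hv
  exact Option.isSome_iff_exists.1 hv

variable [LinearOrder V] (E : Encoding U L V) (P : BQP U L V)

/-- The variables of a query pattern, in increasing order. -/
noncomputable def BQP.varList : List V := (BQP.finite_vars P).toFinset.sort (· ≤ ·)

theorem BQP.mem_varList {P : BQP U L V} {v : V} : v ∈ BQP.varList P ↔ v ∈ BQP.vars P := by
  simp [varList]

theorem BQP.nodup_varList : (BQP.varList P).Nodup := Finset.sort_nodup _ _

/-- A term of a query pattern, with variables replaced by their positions. -/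
noncomputable def codeTerm : V ⊕ (U ⊕ L) → ℕ ⊕ List ℕ
  | Sum.inl v => Sum.inl ((BQP.varList P).idxOf v)
  | Sum.inr x => Sum.inr (E.termDigits x)

/-- A triple pattern, with variables replaced by their positions. -/
noncomputable def codePattern (tp : TriplePattern U L V) :
    (ℕ ⊕ List ℕ) × (ℕ ⊕ List ℕ) × (ℕ ⊕ List ℕ) :=
  (codeTerm E P tp.terms.1, codeTerm E P tp.terms.2.1, codeTerm E P tp.terms.2.2)

/-- The values of a valuation, in the order of the variables. -/
noncomputable def valuationValues (μ : Valuation U L V) : List (List ℕ) :=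
  (BQP.varList P).map fun v => (μ.toFun v).elim [] E.termDigits

variable {E P}

theorem exists_subst_eq {μ : Valuation U L V} (hμ : μ.dom = BQP.vars P) {x : V ⊕ (U ⊕ L)}
    (hx : ∀ v, Sum.inl v = x → v ∈ BQP.vars P) :
    ∃ y, μ.subst x = Sum.inr y ∧
      termVal (valuationValues E P μ) (codeTerm E P x) = E.termDigits y := by
  rcases x with v | x
  · obtain ⟨y, hy⟩ := valuation_eq_some hμ (hx v rfl)
    refine ⟨y, by simp [Valuation.subst, hy], ?_⟩
    have hlt : (BQP.varList P).idxOf v < (BQP.varList P).length :=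
      List.idxOf_lt_length_iff.2 (BQP.mem_varList.2 (hx v rfl))
    simp [termVal, codeTerm, valuationValues, hlt, hy]
  · exact ⟨x, rfl, rfl⟩

/-- All variables of `tp` are in the domain of `μ`, so `μ` leaves none of them; injectivity of the
encoding then compares the components. -/
theorem apply_eq_toTuple_iff {μ : Valuation U L V} (hμ : μ.dom = BQP.vars P)
    {tp : TriplePattern U L V} (htp : tp ∈ P) {t : DataTriple U L} :
    t.toTuple = μ.apply tp ↔
      E.tripleDigits t = tripleVal (valuationValues E P μ) (codePattern E P tp) := by
  have hv : ∀ v, v ∈ tp.vars → v ∈ BQP.vars P := fun v h => ⟨tp, htp, h⟩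
  obtain ⟨y₁, h₁, h₁'⟩ := exists_subst_eq (E := E) hμ (x := tp.terms.1) fun v h =>
    hv v (TriplePattern.mem_vars.2 (Or.inl h))
  obtain ⟨y₂, h₂, h₂'⟩ := exists_subst_eq (E := E) hμ (x := tp.terms.2.1) fun v h =>
    hv v (TriplePattern.mem_vars.2 (Or.inr (Or.inl h)))
  obtain ⟨y₃, h₃, h₃'⟩ := exists_subst_eq (E := E) hμ (x := tp.terms.2.2) fun v h =>
    hv v (TriplePattern.mem_vars.2 (Or.inr (Or.inr h)))
  have e : μ.apply tp = (Sum.inr y₁, Sum.inr y₂, Sum.inr y₃) := by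
    rw [← h₁, ← h₂, ← h₃]
    rfl
  rw [e, tripleVal, codePattern, h₁', h₂', h₃']
  simp [DataTriple.toTuple, Encoding.tripleDigits, E.termDigits_injective.eq_iff]

theorem valuationValues_injOn {μ ν : Valuation U L V} (hμ : μ.dom = BQP.vars P)
    (hν : ν.dom = BQP.vars P) (h : valuationValues E P μ = valuationValues E P ν) : μ = ν := by
  have : μ.toFun = ν.toFun := by
    funext v
    by_cases hv : v ∈ BQP.vars P
    · obtain ⟨y, hy⟩ := valuation_eq_some hμ hv
      obtain ⟨z, hz⟩ := valuation_eq_some hν hv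
      have := List.map_inj_left.1 h v (BQP.mem_varList.2 hv)
      rw [hy, hz] at this ⊢
      rw [E.termDigits_injective this]
    · have h1 : v ∉ μ.dom := hμ ▸ hv
      have h2 : v ∉ ν.dom := hν ▸ hv
      simp only [Valuation.dom, Set.mem_ofPred_eq, Option.not_isSome_iff_eq_none] at h1 h2
      rw [h1, h2]
  cases μ
  cases ν
  simpa using this

/-- Turns the separated list into the form produced by `writeAnswer`, which drops the first
separator afterwards. -/
theorem intercalate_eq_tail {α : Type*} (s : α) (l : List (List α)) :
    [s].intercalate l = (l.flatMap (s :: ·)).tail := by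
  induction l with
  | nil => rfl
  | cons x l ih =>
    cases l with
    | nil => simp
    | cons y l =>
      rw [intercalate_cons_cons, ih]
      simp

theorem writeAnswer_valuationValues {μ : Valuation U L V} (hμ : μ.dom = BQP.vars P) :
    writeAnswer ((BQP.varList P).map fun v => (E.var v).map Symb.digit) (valuationValues E P μ) =
      (E.valuation μ).map Symb.digit := by
  have hsort : μ.finite_dom.toFinset.sort (· ≤ ·) = BQP.varList P := by
    unfold BQP.varList
    congr 1
    ext v
    simp only [Set.Finite.mem_toFinset]
    rw [← hμ]
    rfl
  have hl : ∀ l : List V, ((List.range (l.map fun v => (E.var v).map Symb.digit).length).flatMap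
      fun i => 7 :: ((l.map fun v => (E.var v).map Symb.digit).getD i [] ++
        8 :: (l.map fun v => (μ.toFun v).elim [] E.termDigits).getD i [])) =
      (l.flatMap fun v => Symb.comma :: (E.var v ++ [Symb.arrow] ++
        (μ.toFun v).elim [] E.term)).map Symb.digit := by
    intro l
    induction l with
    | nil => rfl
    | cons v l ih =>
      rw [List.map_cons, List.length_cons, List.range_succ_eq_map, List.flatMap_cons,
        List.flatMap_map, List.flatMap_cons, List.map_append]
      congr 1
      · cases h : μ.toFun v <;> simp [h, Symb.digit, Encoding.termDigits]
  rw [writeAnswer, valuationValues, hl, Encoding.valuation, hsort, intercalate_eq_tail,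
    List.flatMap_map]
  simp [Symb.digit, List.map_tail]

variable [LinearOrder U] [LinearOrder L]

/-- The solutions of a query, in terms of the triples that have been read. -/
theorem mem_cldQuery_cNone_iff {S : Finset U} {W : Web U L} {μ : Valuation U L V} :
    μ ∈ cldQuery P S cNone W ↔ μ.dom = BQP.vars P ∧
      ∀ p ∈ P.toList.map (codePattern E P), tripleVal (valuationValues E P μ) p ∈
        S.toList.flatMap (E.responseTriples W) := by
  refine and_congr_right fun hμ => ?_
  rw [Set.image_subset_iff]
  simp only [List.mem_map, Finset.mem_toList, forall_exists_index, and_imp,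
    forall_apply_eq_imp_iff₂]
  refine forall₂_congr fun tp htp => ?_
  simp only [Set.mem_preimage, Set.mem_image, mem_reachablePart_allData, reachable_cNone_iff,
    List.mem_flatMap, Finset.mem_toList, Encoding.mem_responseTriples,
    apply_eq_toTuple_iff (E := E) hμ htp]
  constructor
  · rintro ⟨t, ⟨d, ⟨u, hu, hd⟩, ht⟩, he⟩
    exact ⟨u, hu, d, hd, t, ht, he⟩
  · rintro ⟨u, hu, d, hd, t, ht, he⟩
    exact ⟨t, ⟨d, ⟨u, hu, hd⟩, ht⟩, he⟩

/-- Completeness of the search: each variable occurs in a pattern whose image is a triple that was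
read, so its value is among the candidates. -/
theorem valuationValues_mem_answers {S : Finset U} {W : Web U L} {μ : Valuation U L V}
    (hμ : μ ∈ cldQuery P S cNone W) :
    valuationValues E P μ ∈ answers (BQP.varList P).length (P.toList.map (codePattern E P))
      (S.toList.flatMap (E.responseTriples W)) := by
  obtain ⟨hdom, hps⟩ := (mem_cldQuery_cNone_iff (E := E)).1 hμ
  refine mem_answers.2 ⟨by simp [valuationValues], fun x hx => ?_, hps⟩
  obtain ⟨v, hv, rfl⟩ := List.mem_map.1 hx
  obtain ⟨tp, htp, hv'⟩ := BQP.mem_varList.1 hv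
  refine ⟨_, hps _ (List.mem_map_of_mem (Finset.mem_toList.2 htp)), ?_⟩
  have hval : (μ.toFun v).elim [] E.termDigits =
      termVal (valuationValues E P μ) (codeTerm E P (Sum.inl v)) := by
    have hlt := List.idxOf_lt_length_iff.2 hv
    simp [termVal, codeTerm, valuationValues, hlt]
  rw [hval]
  rcases TriplePattern.mem_vars.1 hv' with h | h | h <;> rw [h] <;> simp [tripleVal, codePattern]

/-- Soundness of the search: each entry of an answer is a component of a triple that was read, hence
encodes an identifier or literal and can be decoded. -/
theorem exists_valuation_of_mem_answers {S : Finset U} {W : Web U L} {a : List (List ℕ)}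
    (ha : a ∈ answers (BQP.varList P).length (P.toList.map (codePattern E P))
      (S.toList.flatMap (E.responseTriples W))) :
    ∃ μ ∈ cldQuery P S cNone W, valuationValues E P μ = a := by
  obtain ⟨hlen, hterm, hps⟩ := mem_answers.1 ha
  have hex : ∀ x ∈ a, ∃ y, E.termDigits y = x := by
    intro x hx
    obtain ⟨t, ht, hxt⟩ := hterm x hx
    obtain ⟨u, -, hu⟩ := List.mem_flatMap.1 ht
    obtain ⟨d, -, t, -, rfl⟩ := E.mem_responseTriples.1 hu
    simp only [Encoding.tripleDigits, List.mem_cons, List.not_mem_nil, or_false] at hxt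
    rcases hxt with h | h | h
    exacts [⟨_, h.symm⟩, ⟨_, h.symm⟩, ⟨_, h.symm⟩]
  choose g hg using hex
  -- For a variable not in the list, `idxOf` is the length of the list, so `f` is undefined there
  -- and its domain is exactly the set of variables of `P`.
  let f : V → Option (U ⊕ L) := fun v =>
    if h : (BQP.varList P).idxOf v < a.length then some (g _ (List.getElem_mem h)) else none
  have hf : ∀ v, (f v).isSome ↔ v ∈ BQP.vars P := by
    intro v
    rw [← BQP.mem_varList, ← List.idxOf_lt_length_iff, ← hlen]
    by_cases h : (BQP.varList P).idxOf v < a.length <;> simp [f, h]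
  have hdom : {v | (f v).isSome} = BQP.vars P := Set.ext hf
  let μ : Valuation U L V := ⟨f, hdom ▸ BQP.finite_vars P⟩
  have hval : valuationValues E P μ = a := by
    refine List.ext_getElem (by simp [valuationValues, hlen]) fun i h1 h2 => ?_
    have h3 : i < (BQP.varList P).length := hlen ▸ h2
    have hi : (BQP.varList P).idxOf (BQP.varList P)[i] = i :=
      (BQP.nodup_varList P).idxOf_getElem i h3
    have : f (BQP.varList P)[i] = some (g a[i] (List.getElem_mem h2)) := by
      simp only [f, hi, h2, dif_pos]
    simp only [valuationValues, List.getElem_map]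
    change (f (BQP.varList P)[i]).elim [] E.termDigits = a[i]
    rw [this]
    exact hg _ _
  refine ⟨μ, (mem_cldQuery_cNone_iff (E := E)).2 ⟨hdom, ?_⟩, hval⟩
  rw [hval]
  exact hps

/-- Every conjunctive query without link traversal is finitely computable. -/
theorem finitelyComputable_cldQuery_cNone [LocallyFiniteOrderBot U] (E : Encoding U L V)
    (P : BQP U L V) (S : Finset U) : FinitelyComputable E (cldQuery P S cNone) := by
  classical
  set names := (BQP.varList P).map fun v => (E.var v).map Symb.digit with hnames
  set ps := P.toList.map (codePattern E P) with hps
  refine finitelyComputable_of_lookup E S.toList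
    (f := fun n => digitsNum (writeAnswers names ps (numDigits n)))
    (primrec_digitsNum.comp ((primrec_writeAnswers names ps).comp primrec_numDigits)).to_comp
    _ fun W => ?_
  set A := answers (BQP.varList P).length ps (S.toList.flatMap (E.responseTriples W)) with hA
  -- Each answer is decoded to a solution. As `valuationValues` is a left inverse of `g`, different
  -- answers give different solutions.
  choose g hg using fun a : {a // a ∈ A} => exists_valuation_of_mem_answers a.2
  refine ⟨(A.attach.map g).flatMap E.valuation, ⟨A.attach.map g, ?_, fun μ => ?_, rfl⟩, ?_⟩
  · refine (List.nodup_attach.2 (nodup_answers _ _ _)).map fun a b hab => Subtype.ext ?_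
    rw [← (hg a).2, ← (hg b).2, hab]
  · constructor
    · intro hμ
      obtain ⟨a, -, rfl⟩ := List.mem_map.1 hμ
      exact (hg a).1
    · intro hμ
      have ha : valuationValues E P μ ∈ A := valuationValues_mem_answers hμ
      refine List.mem_map.2 ⟨⟨_, ha⟩, List.mem_attach _ _, ?_⟩
      exact valuationValues_injOn (E := E) (hg _).1.1 hμ.1 (hg ⟨_, ha⟩).2
  · have hdig : ∀ l : List Symb, ∀ d ∈ l.map Symb.digit, d < 16 := by
      intro l d hd
      obtain ⟨s, -, rfl⟩ := List.mem_map.1 hd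
      exact s.digit_lt
    rw [numDigits_digitsNum (hdig _), writeAnswers, E.readTriples_lookups,
      show names.length = (BQP.varList P).length by simp [hnames], ← hA]
    congr 1
    rw [List.map_flatMap, List.flatMap_map]
    conv_lhs => rw [← List.attach_map_subtype_val A, List.flatMap_map]
    congr 1
    funext a
    rw [← writeAnswer_valuationValues (hg a).1.1, (hg a).2]

end Query

/-- Without seed identifiers, the reachability criterion is irrelevant. -/
theorem cldQuery_empty_eq {U L V : Type*} (P : BQP U L V) (c : ReachabilityCriterion U L V) :
    cldQuery P ∅ c = cldQuery P ∅ cNone := by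
  have h : ∀ (c : ReachabilityCriterion U L V) (W : Web U L) (d : W.D),
      ¬ Reachable ∅ c P W d := by
    intro c W d hd
    -- A link starts at a document that is already reached, so without seeds there is no first
    -- document.
    induction hd with
    | seed u d hu _ => simp at hu
    | link _ _ _ _ _ _ _ _ _ ih => exact ih
  funext W
  have he : ∀ c : ReachabilityCriterion U L V, (reachablePart ∅ c P W).allData = ∅ := by
    intro c
    refine Set.eq_empty_of_forall_notMem fun t ht => ?_
    obtain ⟨d, hd, -⟩ := mem_reachablePart_allData.1 ht
    exact h c W d hd
  simp only [cldQuery, he]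

end LinkedData

theorem mainTheorem11 {U L V : Type*} [LinearOrder U] [LocallyFiniteOrderBot U] [LinearOrder L]
    [LinearOrder V] (E : LinkedData.Encoding U L V) (P : LinkedData.BQP U L V) :
    (∀ c : LinkedData.ReachabilityCriterion U L V,
      LinkedData.FinitelyComputable E (LinkedData.cldQuery P ∅ c)) ∧
    (∀ S : Finset U, LinkedData.FinitelyComputable E (LinkedData.cldQuery P S LinkedData.cNone)) :=
  ⟨fun c => LinkedData.cldQuery_empty_eq P c ▸
      LinkedData.finitelyComputable_cldQuery_cNone E P ∅,
    LinkedData.finitelyComputable_cldQuery_cNone E P⟩
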